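/- Let $\lambda>0$, $s>\frac12+1$, and let $f:\mathbb R\to\mathbb R$ satisfy Assumptions (H): $f$ is (locally) Lipschitz, $f(0)=0$, $f'(0)=a$ is a constant independent of $\varepsilon$ and $\lambda$, and $f(u)=au+h(u)$ with $h$ a polynomial all of whose terms have degree at least $2$. For $\varepsilon>0$ put $$M_1(u)=\frac u2+\frac{\varepsilon f(u)}{2\lambda},\qquad M_2(u)=\frac u2-\frac{\varepsilon f(u)}{2\lambda},$$ and consider the BGK system $$\partial_t f_1+\frac\lambda\varepsilon\,\partial_x f_1=\frac1{\varepsilon^2}\bigl(M_1(u)-f_1\bigr),\qquad \partial_t f_2-\frac\lambda\varepsilon\,\partial_x f_2=\frac1{\varepsilon^2}\bigl(M_2(u)-f_2\bigr),\qquad u=f_1+f_2,$$ on $x\in\mathbb R$, with the well-prepared initial data $$f_1(0,\cdot)=M_1(u_0)-\frac{\varepsilon\lambda}{2}\partial_xu_0,\qquad f_2(0,\cdot)=M_2(u_0)+\frac{\varepsilon\lambda}{2}\partial_xu_0,\qquad u_0\in H^{s+1}(\mathbb R)$$ ($u_0$ is identified with its continuous representative; solutions are classical, that is, $C^1$). For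 every $M_0\ge 0$ there are $T^*>0$, $\varepsilon_0>0$ and $R>0$, depending only on $\lambda,f,s,M_0$ (in particular independent of $\varepsilon$), such that the following holds. Let $\eta$ be a quadratic convex entropy for $\partial_t\bar u+\partial_xf(\bar u)=0$, that is, a quadratic polynomial with $\eta''>0$ (an entropy flux is any $Q$ with $Q'=\eta'f'$). Then there are constants $c,C>0$, independent of $\varepsilon$ and $u_0$, such that for every $\varepsilon\in(0,\varepsilon_0]$ there are convex $C^2$ functions $\mathcal H_1,\mathcal H_2:\mathbb R\to\mathbb R$ for which $\mathcal H(g_1,g_2)=\mathcal H_1(g_1)+\mathcal H_2(g_2)$ has the following properties. (i) $\mathcal H$ is a kinetic convex dissipative entropy that relaxes $\eta$. For $|v|\le R$, $$\eta(v)=\min_{g_1+g_2=v}\mathcal H(g_1,g_2)=\mathcal H(M_1(v),M_2(v)),$$ and $\mathcal H'(M_1(v),M_2(v))$ vanishes on $\{g_1+g_2=0\}$. For all $g=(g_1,g_2)\in\mathbb R^2$ with $|g_1+g_2|\le R$, $$\mathcal H'(g)\bigl(M(g_1+g_2)-g\bigr)\le -c\,|g-M(g_1+g_2)|^2,\qquad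 M=(M_1,M_2).$$ (ii) For $|v|\le R$ and $i=1,2$, $$\mathcal H_i'(M_i(v))=\eta'(v),\qquad \bigl|\mathcal H_i''(M_i(v))-2\eta''(v)\bigr|\le C\varepsilon .$$ (iii) For every $u_0$ with $\|u_0\|_{s+1}\le M_0$, a classical solution $(f_1,f_2)$ with the above initial data exists on $[0,T^*]\times\mathbb R$, and every such solution satisfies $|f_1|,|f_2|,|u|\le R$ there (so that (i) and (ii) apply along it) together with $$\partial_t\mathcal H(f_1,f_2)+\frac\lambda\varepsilon\,\partial_x\bigl(\mathcal H_1(f_1)-\mathcal H_2(f_2)\bigr)=\frac1{\varepsilon^2}\mathcal H'(f_1,f_2)\bigl(M(u)-(f_1,f_2)\bigr)\le\frac1{\varepsilon^2}\bigl(\mathcal H(M(u))-\mathcal H(f_1,f_2)\bigr)\le 0,$$ where the left-hand side is also at most $-\frac{c}{\varepsilon^2}\,|(f_1,f_2)-M(u)|^2$. -/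

import Mathlib

open scoped ENNReal NNReal

noncomputable section

/-- Standing assumptions on the flux: `f` is (locally) Lipschitz, `f 0 = 0`, `f' 0 = a`, and
`f u = a u + h u` with `h` a polynomial all of whose terms have degree at least `2`. -/
structure FluxAssumptions (a : ℝ) (f : ℝ → ℝ) : Prop where
  lipschitz : LocallyLipschitz f
  map_zero : f 0 = 0
  deriv_zero : HasDerivAt f a 0
  eq_poly : ∃ h : Polynomial ℝ, Polynomial.X ^ 2 ∣ h ∧ ∀ u, f u = a * u + h.eval u

/-- The Maxwellian `M₁ u = u / 2 + ε f(u) / (2 λ)`. -/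
def maxwellian₁ (lam eps : ℝ) (f : ℝ → ℝ) (u : ℝ) : ℝ := u / 2 + eps * f u / (2 * lam)

/-- The Maxwellian `M₂ u = u / 2 - ε f(u) / (2 λ)`. -/
def maxwellian₂ (lam eps : ℝ) (f : ℝ → ℝ) (u : ℝ) : ℝ := u / 2 - eps * f u / (2 * lam)

/-- The first component of the well-prepared initial datum,
`M₁(u₀) - (ε λ / 2) ∂ₓ u₀`. -/
def wellPrepared₁ (lam eps : ℝ) (f u₀ : ℝ → ℝ) (x : ℝ) : ℝ :=
  maxwellian₁ lam eps f (u₀ x) - eps * lam / 2 * deriv u₀ x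

/-- The second component of the well-prepared initial datum,
`M₂(u₀) + (ε λ / 2) ∂ₓ u₀`. -/
def wellPrepared₂ (lam eps : ℝ) (f u₀ : ℝ → ℝ) (x : ℝ) : ℝ :=
  maxwellian₂ lam eps f (u₀ x) + eps * lam / 2 * deriv u₀ x

/-- `(f₁, f₂)` (functions of time, then space) is a classical (`C¹`) solution on `[0, T] × ℝ` of
the diffusively scaled BGK system
`∂ₜ f₁ + (λ/ε) ∂ₓ f₁ = (M₁(u) - f₁) / ε²`, `∂ₜ f₂ - (λ/ε) ∂ₓ f₂ = (M₂(u) - f₂) / ε²`,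
`u = f₁ + f₂`. -/
structure IsBGKSolution (lam eps : ℝ) (f : ℝ → ℝ) (T : ℝ) (f₁ f₂ : ℝ → ℝ → ℝ) : Prop where
  contDiffOn₁ : ContDiffOn ℝ 1 (fun p : ℝ × ℝ => f₁ p.1 p.2) (Set.Icc 0 T ×ˢ Set.univ)
  contDiffOn₂ : ContDiffOn ℝ 1 (fun p : ℝ × ℝ => f₂ p.1 p.2) (Set.Icc 0 T ×ˢ Set.univ)
  eqn₁ : ∀ t ∈ Set.Icc 0 T, ∀ x : ℝ,
    derivWithin (fun τ => f₁ τ x) (Set.Icc 0 T) t + lam / eps * deriv (fun y => f₁ t y) x =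
      1 / eps ^ 2 * (maxwellian₁ lam eps f (f₁ t x + f₂ t x) - f₁ t x)
  eqn₂ : ∀ t ∈ Set.Icc 0 T, ∀ x : ℝ,
    derivWithin (fun τ => f₂ τ x) (Set.Icc 0 T) t - lam / eps * deriv (fun y => f₂ t y) x =
      1 / eps ^ 2 * (maxwellian₂ lam eps f (f₁ t x + f₂ t x) - f₂ t x)

/-- The classical solutions on `[0, T] × ℝ` that start from the well-prepared datum of `u₀`. -/
structure IsWellPreparedSolution (lam eps : ℝ) (f u₀ : ℝ → ℝ) (T : ℝ) (f₁ f₂ : ℝ → ℝ → ℝ) : Prop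
    extends IsBGKSolution lam eps f T f₁ f₂ where
  init₁ : ∀ x, f₁ 0 x = wellPrepared₁ lam eps f u₀ x
  init₂ : ∀ x, f₂ 0 x = wellPrepared₂ lam eps f u₀ x

/-- The norm of a real function in the Sobolev space `H^σ(ℝ)`, `σ ≥ 0`:
`‖u‖_σ = ‖(1 + |2πξ|²)^(σ/2) û(ξ)‖_{L²}`, where `û(ξ) = ∫ exp(-2πixξ) u(x) dx` is the Fourier
transform on `L²`; the value is `∞` if `u` is not in `H^σ(ℝ)`. -/
def sobolevNorm (σ : ℝ) (u : ℝ → ℝ) : ℝ≥0∞ :=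
  open Classical in
  if h : MeasureTheory.MemLp (fun x => (u x : ℂ)) 2 MeasureTheory.volume then
    MeasureTheory.eLpNorm
      (fun ξ : ℝ => (((1 + (2 * Real.pi * ξ) ^ 2) ^ (σ / 2) : ℝ) : ℂ) *
        (MeasureTheory.Lp.fourierTransformₗᵢ ℝ ℂ (h.toLp (fun x => (u x : ℂ))) : ℝ → ℂ) ξ)
      2 MeasureTheory.volume
  else ∞

/-- `η` is a quadratic convex entropy for the conservation law `∂ₜ u + ∂ₓ f(u) = 0`: a quadratic
polynomial with `η'' > 0` that has an entropy flux `Q`, `Q' = η' f'`. -/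
structure IsQuadraticEntropy (f η : ℝ → ℝ) : Prop where
  quadratic : ∃ α β γ : ℝ, 0 < α ∧ ∀ u, η u = α * u ^ 2 + β * u + γ
  flux : ∃ Q : ℝ → ℝ, ∀ u, HasDerivAt Q (deriv η u * deriv f u) u

/-- `ℋ(g₁, g₂) = H₁(g₁) + H₂(g₂)` is a kinetic convex dissipative entropy of the BGK system which
relaxes `η`, for equilibrium states `|v| ≤ R`, with dissipation constant `c`:
* `H₁`, `H₂` are convex functions of class `C²` on `ℝ`;
* `η(v) = min {ℋ(g₁, g₂) | g₁ + g₂ = v} = ℋ(M₁(v), M₂(v))`;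
* `ℋ'(M(v))` is orthogonal to the kernel of `(g₁, g₂) ↦ g₁ + g₂`;
* `ℋ'(g) (M(v) - g) ≤ - c |g - M(v)|²` where `v = g₁ + g₂`. -/
structure IsKineticEntropy (lam eps : ℝ) (f η : ℝ → ℝ) (R c : ℝ) (H₁ H₂ : ℝ → ℝ) : Prop where
  contDiff₁ : ContDiff ℝ 2 H₁
  contDiff₂ : ContDiff ℝ 2 H₂
  convex₁ : ConvexOn ℝ Set.univ H₁
  convex₂ : ConvexOn ℝ Set.univ H₂
  isLeast : ∀ v, |v| ≤ R →
    IsLeast {y | ∃ g₁ g₂ : ℝ, g₁ + g₂ = v ∧ y = H₁ g₁ + H₂ g₂} (η v)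
  equilibrium : ∀ v, |v| ≤ R →
    H₁ (maxwellian₁ lam eps f v) + H₂ (maxwellian₂ lam eps f v) = η v
  orthogonal : ∀ v, |v| ≤ R → ∀ g₁ g₂ : ℝ, g₁ + g₂ = 0 →
    deriv H₁ (maxwellian₁ lam eps f v) * g₁ + deriv H₂ (maxwellian₂ lam eps f v) * g₂ = 0
  dissipative : ∀ g₁ g₂ : ℝ, |g₁ + g₂| ≤ R →
    deriv H₁ g₁ * (maxwellian₁ lam eps f (g₁ + g₂) - g₁) +
        deriv H₂ g₂ * (maxwellian₂ lam eps f (g₁ + g₂) - g₂) ≤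
      -c * ((g₁ - maxwellian₁ lam eps f (g₁ + g₂)) ^ 2 +
        (g₂ - maxwellian₂ lam eps f (g₁ + g₂)) ^ 2)

/-- The entropy production `∂ₜ ℋ(f₁, f₂) + (λ/ε) ∂ₓ (H₁(f₁) - H₂(f₂))` at the point `(t, x)` of
`[0, T] × ℝ`. -/
def entropyProduction (lam eps T : ℝ) (H₁ H₂ : ℝ → ℝ) (f₁ f₂ : ℝ → ℝ → ℝ) (t x : ℝ) : ℝ :=
  derivWithin (fun τ => H₁ (f₁ τ x) + H₂ (f₂ τ x)) (Set.Icc 0 T) t +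
    lam / eps * deriv (fun y => H₁ (f₁ t y) - H₂ (f₂ t y)) x

/-- The entropy inequalities satisfied by `ℋ(g₁, g₂) = H₁(g₁) + H₂(g₂)` along `(f₁, f₂)` on
`[0, T] × ℝ`: the entropy production equals `ε⁻² ℋ'(f) (M(u) - f)`, which is at most
`ε⁻² (ℋ(M(u)) - ℋ(f)) ≤ 0`, and it is at most `- (c / ε²) |f - M(u)|²`. -/
structure SatisfiesEntropyInequality (lam eps : ℝ) (f : ℝ → ℝ) (T c : ℝ) (H₁ H₂ : ℝ → ℝ)
    (f₁ f₂ : ℝ → ℝ → ℝ) : Prop where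
  balance : ∀ t ∈ Set.Icc 0 T, ∀ x,
    entropyProduction lam eps T H₁ H₂ f₁ f₂ t x =
      1 / eps ^ 2 *
        (deriv H₁ (f₁ t x) * (maxwellian₁ lam eps f (f₁ t x + f₂ t x) - f₁ t x) +
          deriv H₂ (f₂ t x) * (maxwellian₂ lam eps f (f₁ t x + f₂ t x) - f₂ t x))
  le_gap : ∀ t ∈ Set.Icc 0 T, ∀ x,
    entropyProduction lam eps T H₁ H₂ f₁ f₂ t x ≤
      1 / eps ^ 2 *
        ((H₁ (maxwellian₁ lam eps f (f₁ t x + f₂ t x)) +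
            H₂ (maxwellian₂ lam eps f (f₁ t x + f₂ t x))) -
          (H₁ (f₁ t x) + H₂ (f₂ t x)))
  gap_nonpos : ∀ t ∈ Set.Icc 0 T, ∀ x,
    H₁ (maxwellian₁ lam eps f (f₁ t x + f₂ t x)) +
        H₂ (maxwellian₂ lam eps f (f₁ t x + f₂ t x)) ≤
      H₁ (f₁ t x) + H₂ (f₂ t x)
  strict : ∀ t ∈ Set.Icc 0 T, ∀ x,
    entropyProduction lam eps T H₁ H₂ f₁ f₂ t x ≤
      -(c / eps ^ 2) *
        ((f₁ t x - maxwellian₁ lam eps f (f₁ t x + f₂ t x)) ^ 2 +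
          (f₂ t x - maxwellian₂ lam eps f (f₁ t x + f₂ t x)) ^ 2)

end

/-! Since `s + 1 > 5/2`, the datum u₀ is of class C², and u₀, u₀', u₀'' are bounded by some K = A M₀
(`sobolevNorm_embedding`). Put R = K + 1 and let G bound f' on [-R, R]. Everything rests on the
subcharacteristic condition ε G ≤ λ/2: it keeps M₁' and M₂' in [1/4, 3/4] there, so both Maxwellians
increase, and their sum is the identity.

Invariant region: along its characteristics each fᵢ is a weighted average of its initial value and
of past values of Mᵢ(u). By monotonicity fᵢ stays in [Mᵢ(-R), Mᵢ(R)] and u in [-R, R], provided the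
data start there, which ε λ K ≤ 1/2 ensures. Picard iteration then gives a classical solution for
all times (`exists_relaxation_solution`, `exists_wellPreparedSolution`), so any T* would do.
Uniqueness in cones of dependence (`relaxation_solution_unique`) carries the bounds over to every
classical solution.

Entropy: take Hᵢ' = η' ∘ Mᵢ⁻¹ (`exists_entropy_component`, `exists_kineticEntropy`). This increases,
so Hᵢ is convex; as Mᵢ' ≤ 1, it is strongly monotone with modulus η'', which gives the dissipation
with c = η''. At M(v) both Hᵢ' equal η'(v), so supporting lines make M(v) a minimizer on g₁ + g₂ =
v, and M₁' + M₂' = 1 makes the minimum η(v). Finally Hᵢ''(Mᵢ(v)) = η''/Mᵢ'(v) with Mᵢ' = 1/2 + O(ε).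
To invert Mᵢ on all of ℝ, the flux is cut off away from [-R, R] (`exists_cutoff`). Along solutions,
the inequalities follow from the chain rule and convexity. -/

/-! ### Sobolev embedding into functions with two bounded derivatives -/

open MeasureTheory FourierTransform in
/-- On `L¹ ∩ L²` the inverse Fourier transform of `L²` is given by the Fourier integral. -/
theorem fourierInv_Lp_ae_eq (G : Lp ℂ 2 (volume : Measure ℝ)) (hG : Integrable (G : ℝ → ℂ)) :
    (𝓕⁻ G : Lp ℂ 2 (volume : Measure ℝ)) =ᵐ[volume] 𝓕⁻ (G : ℝ → ℂ) := by
  have hcont : Continuous (𝓕⁻ (G : ℝ → ℂ)) := by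
    have : Continuous (𝓕 (G : ℝ → ℂ)) :=
      VectorFourier.fourierIntegral_continuous Real.continuous_fourierChar
        (by exact continuous_inner) hG
    have h2 : 𝓕⁻ (G : ℝ → ℂ) = fun x => 𝓕 (G : ℝ → ℂ) (-x) := by
      ext x; exact Real.fourierInv_eq_fourier_neg _ _
    rw [h2]; exact this.comp continuous_neg
  -- Both sides are locally integrable, so it suffices to pair them with test functions. There the
  -- inverse transform moves onto the test function: on the left by its definition for tempered
  -- distributions, on the right by Fubini (`h3`).
  apply ae_eq_of_integral_contDiff_smul_eq
  · exact (Lp.memLp _).locallyIntegrable (by norm_num)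
  · exact hcont.locallyIntegrable
  intro g g_smooth g_cpt
  have hg₁ : HasCompactSupport (Complex.ofRealCLM ∘ g) := g_cpt.comp_left rfl
  have hg₂ : ContDiff ℝ ((⊤ : ℕ∞) : WithTop ℕ∞) (Complex.ofRealCLM ∘ g) := by fun_prop
  set φ := hg₁.toSchwartzMap hg₂ with hφ
  have h1 : ∫ x, g x • (𝓕⁻ G : Lp ℂ 2 (volume : Measure ℝ)) x
      = Lp.toTemperedDistribution (𝓕⁻ G : Lp ℂ 2 (volume : Measure ℝ)) φ := by
    simp [hφ]
  rw [h1, ← Lp.fourierInv_toTemperedDistribution_eq]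
  have h2 : (𝓕⁻ (Lp.toTemperedDistribution G)) φ = Lp.toTemperedDistribution G (𝓕⁻ φ) := by
    simp
  rw [h2, Lp.toTemperedDistribution_apply]
  have h3 := VectorFourier.integral_fourierIntegral_smul_eq_flip (μ := volume) (ν := volume)
    (L := -innerₗ ℝ) (f := φ) (g := (G : ℝ → ℂ)) Real.continuous_fourierChar
    (by exact (continuous_inner (𝕜 := ℝ) (E := ℝ)).neg) φ.integrable hG
  have h4 : (fun ξ => (𝓕⁻ φ) ξ) = VectorFourier.fourierIntegral Real.fourierChar volume (-innerₗ ℝ) φ := by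
    ext ξ
    rw [SchwartzMap.fourierInv_coe]
    rfl
  have h5 : 𝓕⁻ (G : ℝ → ℂ) =
      VectorFourier.fourierIntegral Real.fourierChar volume (-innerₗ ℝ).flip (G : ℝ → ℂ) := by
    ext x
    simp only [VectorFourier.fourierIntegral, Real.fourierInv_eq]
    congr 1
    ext v
    simp [mul_comm]
  rw [h5]
  simp only [← h4] at h3
  refine h3.trans ?_
  simp [hφ]

-- The square decays like |ξ|^(4 - 2σ), which is integrable because 2σ - 4 > 1. This is where the
-- threshold 5/2 enters.
open MeasureTheory in
theorem memLp_two_japaneseBracket {σ : ℝ} (hσ : 5 / 2 < σ) :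
    MemLp (fun ξ : ℝ => (((1 + (2 * Real.pi * ξ) ^ 2) ^ (1 - σ / 2) : ℝ) : ℂ)) 2 volume := by
  have hcont : Continuous (fun ξ : ℝ => (((1 + (2 * Real.pi * ξ) ^ 2) ^ (1 - σ / 2) : ℝ) : ℂ)) := by
    apply Complex.continuous_ofReal.comp
    exact Continuous.rpow_const (by fun_prop) fun ξ => Or.inl (by positivity)
  rw [memLp_two_iff_integrable_sq_norm hcont.aestronglyMeasurable]
  have h := integrable_rpow_neg_one_add_norm_sq (E := ℝ) (μ := volume) (r := 2 * σ - 4)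
    (by simp; linarith)
  have h2 := h.comp_mul_left' (R := 2 * Real.pi) (by positivity)
  refine h2.congr (Filter.Eventually.of_forall fun ξ => ?_)
  have hpos : (0 : ℝ) < 1 + (2 * Real.pi * ξ) ^ 2 := by positivity
  simp only [Complex.norm_real, Real.norm_eq_abs, sq_abs]
  rw [← Real.rpow_natCast ((1 + (2 * Real.pi * ξ) ^ 2) ^ (1 - σ / 2)), ← Real.rpow_mul hpos.le]
  congr 1
  push_cast
  ring

open MeasureTheory in
/-- Functions in a weighted `L²` space have two integrable moments. -/
theorem integrable_two_moments {σ : ℝ} (hσ : 5 / 2 < σ) :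
    ∃ A : ℝ≥0, ∀ (M : ℝ≥0) (G : ℝ → ℂ), AEStronglyMeasurable G volume →
      eLpNorm (fun ξ : ℝ => (((1 + (2 * Real.pi * ξ) ^ 2) ^ (σ / 2) : ℝ) : ℂ) * G ξ) 2 volume ≤ M →
      Integrable (fun ξ : ℝ => (1 + (2 * Real.pi * ξ) ^ 2) * ‖G ξ‖) volume ∧
      ∫ ξ : ℝ, (1 + (2 * Real.pi * ξ) ^ 2) * ‖G ξ‖ ≤ (A * M : ℝ) := by
  set b : ℝ → ℂ := fun ξ => (((1 + (2 * Real.pi * ξ) ^ 2) ^ (1 - σ / 2) : ℝ) : ℂ) with hb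
  have hbm : MemLp b 2 volume := memLp_two_japaneseBracket hσ
  refine ⟨(eLpNorm b 2 volume).toNNReal, fun M G hG hM => ?_⟩
  set W : ℝ → ℂ := fun ξ => (((1 + (2 * Real.pi * ξ) ^ 2) ^ (σ / 2) : ℝ) : ℂ) * G ξ with hW
  have hWcont : Continuous (fun ξ : ℝ => (((1 + (2 * Real.pi * ξ) ^ 2) ^ (σ / 2) : ℝ) : ℂ)) := by
    apply Complex.continuous_ofReal.comp
    exact Continuous.rpow_const (by fun_prop) fun ξ => Or.inl (by positivity)
  have hWm : MemLp W 2 volume :=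
    ⟨hWcont.aestronglyMeasurable.mul hG, hM.trans_lt ENNReal.coe_lt_top⟩
  -- The exponents 1 - σ/2 and σ/2 add up to 1, so Cauchy–Schwarz for `b` and `W` bounds the
  -- weighted L¹ norm.
  have key : ∀ ξ, ‖(b • W) ξ‖ = (1 + (2 * Real.pi * ξ) ^ 2) * ‖G ξ‖ := by
    intro ξ
    have hpos : (0 : ℝ) < 1 + (2 * Real.pi * ξ) ^ 2 := by positivity
    simp only [hb, hW, Pi.smul_apply', smul_eq_mul, norm_mul, Complex.norm_real, Real.norm_eq_abs,
      abs_of_pos (Real.rpow_pos_of_pos hpos _)]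
    rw [← mul_assoc, ← Real.rpow_add hpos]
    simp
  have hint : Integrable (b • W) volume := by
    rw [← memLp_one_iff_integrable]
    exact hWm.smul hbm
  refine ⟨hint.norm.congr (Filter.Eventually.of_forall key), ?_⟩
  have h1 : ∫ ξ : ℝ, (1 + (2 * Real.pi * ξ) ^ 2) * ‖G ξ‖ = ∫ ξ, ‖(b • W) ξ‖ :=
    integral_congr_ae (Filter.Eventually.of_forall fun ξ => (key ξ).symm)
  rw [h1, integral_norm_eq_lintegral_enorm hint.aestronglyMeasurable, ← eLpNorm_one_eq_lintegral_enorm]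
  have h2 : eLpNorm (b • W) 1 volume ≤ eLpNorm b 2 volume * eLpNorm W 2 volume :=
    eLpNorm_smul_le_mul_eLpNorm hWm.1 hbm.1
  calc (eLpNorm (b • W) 1 volume).toReal ≤ (eLpNorm b 2 volume * M).toReal := by
        apply ENNReal.toReal_mono (ENNReal.mul_ne_top hbm.2.ne ENNReal.coe_ne_top)
        exact h2.trans (by gcongr)
    _ = _ := by rw [ENNReal.toReal_mul]; rfl

open MeasureTheory FourierTransform in
/-- A Fourier integral whose integrand has two moments is `C²` with bounded derivatives. -/
theorem fourier_two_moments (G : ℝ → ℂ) (hG : AEStronglyMeasurable G volume)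
    (hint : Integrable (fun ξ : ℝ => (1 + (2 * Real.pi * ξ) ^ 2) * ‖G ξ‖) volume) :
    ∃ v₁ v₂ : ℝ → ℂ, (∀ x, HasDerivAt (𝓕 G) (v₁ x) x) ∧ (∀ x, HasDerivAt v₁ (v₂ x) x) ∧
      Continuous v₂ ∧
      (∀ x, ‖𝓕 G x‖ ≤ ∫ ξ : ℝ, (1 + (2 * Real.pi * ξ) ^ 2) * ‖G ξ‖) ∧
      (∀ x, ‖v₁ x‖ ≤ ∫ ξ : ℝ, (1 + (2 * Real.pi * ξ) ^ 2) * ‖G ξ‖) ∧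
      (∀ x, ‖v₂ x‖ ≤ ∫ ξ : ℝ, (1 + (2 * Real.pi * ξ) ^ 2) * ‖G ξ‖) := by
  -- The multiplier that differentiation of the Fourier integral produces; `D G` and `D (D G)` are
  -- dominated by the weight 1 + (2πξ)².
  set D : (ℝ → ℂ) → ℝ → ℂ := fun g ξ => (-2 * Real.pi * Complex.I * ξ) • g ξ with hD
  have hDn : ∀ g ξ, ‖D g ξ‖ = |2 * Real.pi * ξ| * ‖g ξ‖ := by
    intro g ξ
    simp [hD, abs_mul]
  have hDm : ∀ g, AEStronglyMeasurable g volume → AEStronglyMeasurable (D g) volume := by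
    intro g hg
    have : Continuous fun ξ : ℝ => (-2 * Real.pi * Complex.I * ξ : ℂ) := by fun_prop
    exact this.aestronglyMeasurable.smul hg
  have b0 : ∀ ξ, ‖G ξ‖ ≤ (1 + (2 * Real.pi * ξ) ^ 2) * ‖G ξ‖ := fun ξ => by
    nlinarith [norm_nonneg (G ξ), mul_nonneg (sq_nonneg (2 * Real.pi * ξ)) (norm_nonneg (G ξ))]
  have b1 : ∀ ξ, ‖D G ξ‖ ≤ (1 + (2 * Real.pi * ξ) ^ 2) * ‖G ξ‖ := fun ξ => by
    rw [hDn]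
    gcongr
    rw [← sq_abs (2 * Real.pi * ξ)]
    nlinarith [sq_nonneg (|2 * Real.pi * ξ| - 1)]
  have b2 : ∀ ξ, ‖D (D G) ξ‖ ≤ (1 + (2 * Real.pi * ξ) ^ 2) * ‖G ξ‖ := fun ξ => by
    rw [hDn, hDn, ← mul_assoc]
    gcongr
    rw [abs_mul_abs_self]
    nlinarith
  have i0 : Integrable G := hint.mono' hG (Filter.Eventually.of_forall b0)
  have i1 : Integrable (D G) := hint.mono' (hDm _ hG) (Filter.Eventually.of_forall b1)
  have i2 : Integrable (D (D G)) := hint.mono' (hDm _ (hDm _ hG)) (Filter.Eventually.of_forall b2)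
  have imul : ∀ g, Integrable (D g) → Integrable (fun x : ℝ => x • g x) := by
    intro g hg
    have := hg.const_mul ((-2 * Real.pi * Complex.I)⁻¹)
    refine this.congr (Filter.Eventually.of_forall fun ξ => ?_)
    have h1 : (-2 * Real.pi * Complex.I) ≠ 0 := by simp [Real.pi_ne_zero]
    simp only [hD, smul_eq_mul, Complex.real_smul]
    rw [mul_assoc (-2 * Real.pi * Complex.I), inv_mul_cancel_left₀ h1]
  have bound : ∀ g : ℝ → ℂ, (∀ ξ, ‖g ξ‖ ≤ (1 + (2 * Real.pi * ξ) ^ 2) * ‖G ξ‖) →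
      ∀ x, ‖𝓕 g x‖ ≤ ∫ ξ : ℝ, (1 + (2 * Real.pi * ξ) ^ 2) * ‖G ξ‖ := by
    intro g hg x
    rw [Real.fourier_real_eq]
    refine norm_integral_le_of_norm_le hint (Filter.Eventually.of_forall fun ξ => ?_)
    simpa using hg ξ
  refine ⟨𝓕 (D G), 𝓕 (D (D G)), fun x => Real.hasDerivAt_fourier i0 (imul _ i1) x,
    fun x => Real.hasDerivAt_fourier i1 (imul _ i2) x, ?_, bound _ b0, bound _ b1, bound _ b2⟩
  exact VectorFourier.fourierIntegral_continuous Real.continuous_fourierChar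
    (by exact continuous_inner) i2

open MeasureTheory FourierTransform in
/-- The Sobolev embedding `H^σ(ℝ) ⊆ C²_b(ℝ)` for `σ > 5 / 2`. -/
theorem sobolevNorm_embedding {σ : ℝ} (hσ : 5 / 2 < σ) :
    ∃ A : ℝ≥0, ∀ (M : ℝ≥0) (u : ℝ → ℝ), Continuous u → sobolevNorm σ u ≤ M →
      ∃ u₁ u₂ : ℝ → ℝ, (∀ x, HasDerivAt u (u₁ x) x) ∧ (∀ x, HasDerivAt u₁ (u₂ x) x) ∧
        Continuous u₂ ∧ (∀ x, |u x| ≤ (A * M : ℝ)) ∧ (∀ x, |u₁ x| ≤ (A * M : ℝ)) ∧ (∀ x, |u₂ x| ≤ (A * M : ℝ)) := by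
  obtain ⟨A, hA⟩ := integrable_two_moments hσ
  refine ⟨A, fun M u hu hM => ?_⟩
  unfold sobolevNorm at hM
  split_ifs at hM with h
  swap
  · simp at hM
  set U : Lp ℂ 2 (volume : Measure ℝ) := h.toLp (fun x => (u x : ℂ)) with hU
  set G : Lp ℂ 2 (volume : Measure ℝ) := Lp.fourierTransformₗᵢ ℝ ℂ U with hGdef
  obtain ⟨hint, hle⟩ := hA M G (Lp.aestronglyMeasurable G) hM
  have hGint : Integrable (G : ℝ → ℂ) := hint.mono' (Lp.aestronglyMeasurable G)
    (Filter.Eventually.of_forall fun ξ => by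
      nlinarith [norm_nonneg (G ξ), mul_nonneg (sq_nonneg (2 * Real.pi * ξ)) (norm_nonneg (G ξ))])
  have hUG : 𝓕⁻ G = U := (Lp.fourierTransformₗᵢ ℝ ℂ).symm_apply_apply U
  have hae := fourierInv_Lp_ae_eq G hGint
  rw [hUG] at hae
  -- Reflection turns the inverse transform into a forward one; the even weight is unaffected.
  set g : ℝ → ℂ := fun ξ => G (-ξ) with hg
  have hFg : ∀ x, 𝓕⁻ (G : ℝ → ℂ) x = 𝓕 g x := by
    intro x
    rw [Real.fourierInv_eq_fourier_comp_neg]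
  have hgm : AEStronglyMeasurable g volume :=
    (Lp.aestronglyMeasurable G).comp_quasiMeasurePreserving
      (Measure.measurePreserving_neg volume).quasiMeasurePreserving
  have hgi : Integrable (fun ξ : ℝ => (1 + (2 * Real.pi * ξ) ^ 2) * ‖g ξ‖) volume := by
    have := hint.comp_neg
    refine this.congr (Filter.Eventually.of_forall fun ξ => ?_)
    simp [hg]
  have hgle : ∫ ξ : ℝ, (1 + (2 * Real.pi * ξ) ^ 2) * ‖g ξ‖ ≤ (A * M : ℝ) := by
    rw [← integral_neg_eq_self]
    simpa [hg] using hle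
  obtain ⟨v₁, v₂, h1, h2, h3, c0, c1, c2⟩ := fourier_two_moments g hgm hgi
  -- Fourier inversion only gives equality almost everywhere; continuity of both sides makes it
  -- pointwise.
  have huv : (fun x => (u x : ℂ)) = 𝓕 g := by
    refine Continuous.ae_eq_iff_eq volume (Complex.continuous_ofReal.comp hu)
      (continuous_iff_continuousAt.2 fun x => (h1 x).continuousAt) |>.1 ?_
    filter_upwards [hae, h.coeFn_toLp] with x hx hx'
    rw [← hFg, ← hx, hU, hx']
    rfl
  have hure : ∀ x, u x = (𝓕 g x).re := fun x => by rw [← huv]; simp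
  refine ⟨fun x => (v₁ x).re, fun x => (v₂ x).re, fun x => ?_, fun x => ?_, ?_, ?_, ?_, ?_⟩
  · have : u = fun x => (𝓕 g x).re := funext hure
    rw [this]
    exact Complex.reCLM.hasFDerivAt.comp_hasDerivAt x (h1 x)
  · exact Complex.reCLM.hasFDerivAt.comp_hasDerivAt x (h2 x)
  · exact Complex.continuous_re.comp h3
  · intro x
    rw [hure]
    exact (Complex.abs_re_le_norm _).trans ((c0 x).trans hgle)
  · exact fun x => (Complex.abs_re_le_norm _).trans ((c1 x).trans hgle)
  · exact fun x => (Complex.abs_re_le_norm _).trans ((c2 x).trans hgle)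

/-! ### Calculus in two variables and parameter integrals -/

/-- A function of two real variables with continuous partial derivatives is `C¹`. -/
theorem contDiff_one_of_partials {g g₁ g₂ : ℝ → ℝ → ℝ}
    (h₁ : ∀ t x, HasDerivAt (fun τ => g τ x) (g₁ t x) t)
    (h₂ : ∀ t x, HasDerivAt (fun y => g t y) (g₂ t x) x)
    (c₁ : Continuous (Function.uncurry g₁)) (c₂ : Continuous (Function.uncurry g₂)) :
    ContDiff ℝ 1 (fun p : ℝ × ℝ => g p.1 p.2) := by
  -- Identifies a real number with multiplication by it, to turn scalar partial derivatives into
  -- Fréchet ones.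
  set L : ℝ →L[ℝ] ℝ →L[ℝ] ℝ := ContinuousLinearMap.smulRightL ℝ ℝ ℝ 1 with hL
  have hLc : ∀ r : ℝ → ℝ → ℝ, Continuous (Function.uncurry r) →
      Continuous (Function.uncurry fun t x => L (r t x)) := fun r hr => L.continuous.comp hr
  rw [contDiff_one_iff_hasFDerivAt]
  refine ⟨fun p => (L (g₁ p.1 p.2)).coprod (L (g₂ p.1 p.2)), ?_, fun p => ?_⟩
  · have : (fun p : ℝ × ℝ => (L (g₁ p.1 p.2)).coprod (L (g₂ p.1 p.2))) = fun p =>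
        Function.uncurry g₁ p • ContinuousLinearMap.fst ℝ ℝ ℝ +
          Function.uncurry g₂ p • ContinuousLinearMap.snd ℝ ℝ ℝ := by
      funext p
      ext <;> simp [hL, Function.uncurry]
    rw [this]
    exact (c₁.smul continuous_const).add (c₂.smul continuous_const)
  · exact (hasStrictFDerivAt_uncurry_coprod (f := g) (f₁ := fun t x => L (g₁ t x))
      (f₂ := fun t x => L (g₂ t x))
      (Filter.Eventually.of_forall fun v => (h₁ v.1 v.2).hasFDerivAt)
      (Filter.Eventually.of_forall fun v => (h₂ v.1 v.2).hasFDerivAt)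
      (hLc g₁ c₁).continuousAt (hLc g₂ c₂).continuousAt).hasFDerivAt

/-- Differentiation under an interval integral whose integrand is continuously differentiable in
the parameter. -/
theorem hasDerivAt_intervalIntegral_of_continuous {K K' : ℝ → ℝ → ℝ}
    (hK : Continuous (Function.uncurry K)) (hK' : Continuous (Function.uncurry K'))
    (hd : ∀ s y, HasDerivAt (fun z => K s z) (K' s y) y) (t y : ℝ) :
    HasDerivAt (fun z => ∫ s in 0..t, K s z) (∫ s in 0..t, K' s y) y := by
  obtain ⟨B, hB⟩ := (isCompact_uIcc (a := (0 : ℝ)) (b := t)).prod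
    (isCompact_closedBall y 1) |>.exists_bound_of_continuousOn hK'.continuousOn
  have hc : ∀ (r : ℝ → ℝ → ℝ) (z : ℝ), Continuous (Function.uncurry r) →
      Continuous fun s => r s z := fun r z hr => hr.comp (continuous_id.prodMk continuous_const)
  refine (intervalIntegral.hasDerivAt_integral_of_dominated_loc_of_deriv_le
    (F := fun z s => K s z) (F' := fun z s => K' s z) (bound := fun _ => B)
    (Metric.closedBall_mem_nhds y one_pos) ?_ ?_ ?_ ?_ ?_ ?_).2
  · exact Filter.Eventually.of_forall fun z => (hc K z hK).aestronglyMeasurable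
  · exact (hc K y hK).intervalIntegrable _ _
  · exact (hc K' y hK').aestronglyMeasurable
  · exact Filter.Eventually.of_forall fun s hs z hz =>
      hB (s, z) ⟨Set.uIoc_subset_uIcc hs, hz⟩
  · exact intervalIntegrable_const
  · exact Filter.Eventually.of_forall fun s _ z _ => hd s z

/-! ### Damped transport equations and Duhamel's formula -/

/-- The solution of `∂ₜ w + σ ∂ₓ w = κ (S - w)`, `w(0) = φ`, along the characteristic that starts
at `y`, multiplied by `exp (κ t)`. -/
noncomputable def duhamelAlong (κ σ : ℝ) (φ : ℝ → ℝ) (S : ℝ → ℝ → ℝ) (t y : ℝ) : ℝ :=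
  φ y + ∫ s in 0..t, κ * Real.exp (κ * s) * S s (y + σ * s)

/-- The solution of `∂ₜ w + σ ∂ₓ w = κ (S - w)`, `w(0) = φ`. -/
noncomputable def duhamel (κ σ : ℝ) (φ : ℝ → ℝ) (S : ℝ → ℝ → ℝ) (t x : ℝ) : ℝ :=
  Real.exp (-(κ * t)) * duhamelAlong κ σ φ S t (x - σ * t)

section Duhamel

variable {κ σ : ℝ} {φ φ' : ℝ → ℝ} {S S' : ℝ → ℝ → ℝ}

theorem continuous_duhamel_integrand (hS : Continuous (Function.uncurry S)) :
    Continuous (Function.uncurry fun s y => κ * Real.exp (κ * s) * S s (y + σ * s)) := by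
  have h : Continuous fun p : ℝ × ℝ => S p.1 (p.2 + σ * p.1) :=
    hS.comp (by fun_prop : Continuous fun p : ℝ × ℝ => (p.1, p.2 + σ * p.1))
  have h2 : Continuous fun p : ℝ × ℝ => κ * Real.exp (κ * p.1) := by fun_prop
  exact h2.mul h

theorem continuous_duhamel_integrand_left (hS : Continuous (Function.uncurry S)) (y : ℝ) :
    Continuous fun s => κ * Real.exp (κ * s) * S s (y + σ * s) :=
  (continuous_duhamel_integrand hS).comp (continuous_id.prodMk continuous_const)

theorem continuous_duhamelAlong (hφ : Continuous φ) (hS : Continuous (Function.uncurry S)) :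
    Continuous (Function.uncurry (duhamelAlong κ σ φ S)) := by
  have h := continuous_duhamel_integrand (κ := κ) (σ := σ) hS
  have h1 : Continuous (Function.uncurry fun (p : ℝ × ℝ) (s : ℝ) =>
      κ * Real.exp (κ * s) * S s (p.2 + σ * s)) :=
    h.comp (by fun_prop : Continuous fun q : (ℝ × ℝ) × ℝ => (q.2, q.1.2))
  exact (hφ.comp continuous_snd).add
    (intervalIntegral.continuous_parametric_intervalIntegral_of_continuous h1 continuous_fst)

theorem continuous_duhamel (hφ : Continuous φ) (hS : Continuous (Function.uncurry S)) :
    Continuous (Function.uncurry (duhamel κ σ φ S)) := by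
  have h : Continuous fun p : ℝ × ℝ => duhamelAlong κ σ φ S p.1 (p.2 - σ * p.1) :=
    (continuous_duhamelAlong hφ hS).comp
      (by fun_prop : Continuous fun p : ℝ × ℝ => (p.1, p.2 - σ * p.1))
  have h2 : Continuous fun p : ℝ × ℝ => Real.exp (-(κ * p.1)) := by fun_prop
  exact h2.mul h

theorem hasDerivAt_duhamelAlong_space (hφ : ∀ x, HasDerivAt φ (φ' x) x)
    (hS : Continuous (Function.uncurry S)) (hS' : Continuous (Function.uncurry S'))
    (hd : ∀ t x, HasDerivAt (fun y => S t y) (S' t x) x) (t y : ℝ) :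
    HasDerivAt (fun z => duhamelAlong κ σ φ S t z) (duhamelAlong κ σ φ' S' t y) y := by
  refine (hφ y).add (hasDerivAt_intervalIntegral_of_continuous (continuous_duhamel_integrand hS)
    (continuous_duhamel_integrand hS') (fun s y => ?_) t y)
  exact ((hd s (y + σ * s)).comp_add_const y (σ * s)).const_mul _

/-- Space differentiation commutes with the solution operator, so the space derivatives of Picard
iterates obey a recursion of the same kind. -/
theorem hasDerivAt_duhamel_space (hφ : ∀ x, HasDerivAt φ (φ' x) x)
    (hS : Continuous (Function.uncurry S)) (hS' : Continuous (Function.uncurry S'))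
    (hd : ∀ t x, HasDerivAt (fun y => S t y) (S' t x) x) (t x : ℝ) :
    HasDerivAt (fun z => duhamel κ σ φ S t z) (duhamel κ σ φ' S' t x) x :=
  ((hasDerivAt_duhamelAlong_space hφ hS hS' hd t (x - σ * t)).comp_sub_const x (σ * t)).const_mul _

theorem hasDerivAt_duhamelAlong_time (hS : Continuous (Function.uncurry S)) (t y : ℝ) :
    HasDerivAt (fun τ => duhamelAlong κ σ φ S τ y)
      (κ * Real.exp (κ * t) * S t (y + σ * t)) t :=
  ((continuous_duhamel_integrand_left hS y).integral_hasStrictDerivAt 0 t).hasDerivAt.const_add _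

theorem contDiff_duhamel (hφ : ∀ x, HasDerivAt φ (φ' x) x) (hφ' : Continuous φ')
    (hS : Continuous (Function.uncurry S)) (hS' : Continuous (Function.uncurry S'))
    (hd : ∀ t x, HasDerivAt (fun y => S t y) (S' t x) x) :
    ContDiff ℝ 1 (fun p : ℝ × ℝ => duhamel κ σ φ S p.1 p.2) := by
  have h : ContDiff ℝ 1 (fun p : ℝ × ℝ => duhamelAlong κ σ φ S p.1 p.2) :=
    contDiff_one_of_partials (hasDerivAt_duhamelAlong_time hS)
      (hasDerivAt_duhamelAlong_space hφ hS hS' hd) (continuous_duhamel_integrand hS)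
      (continuous_duhamelAlong hφ' hS')
  have h2 : ContDiff ℝ 1 (fun p : ℝ × ℝ => Real.exp (-(κ * p.1))) := by fun_prop
  exact h2.mul (h.comp (by fun_prop : ContDiff ℝ 1 fun p : ℝ × ℝ => (p.1, p.2 - σ * p.1)))

/-- In the coordinates (t, x - σt) the operator ∂ₜ + σ∂ₓ is the time derivative alone: the two
σ-terms cancel, the integral contributes κS and the exponential factor the damping. -/
theorem duhamel_transport_eq (hφ : ∀ x, HasDerivAt φ (φ' x) x) (hφ' : Continuous φ')
    (hS : Continuous (Function.uncurry S)) (hS' : Continuous (Function.uncurry S'))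
    (hd : ∀ t x, HasDerivAt (fun y => S t y) (S' t x) x) (t x : ℝ) :
    deriv (fun τ => duhamel κ σ φ S τ x) t + σ * deriv (fun y => duhamel κ σ φ S t y) x =
      κ * (S t x - duhamel κ σ φ S t x) := by
  have h : ContDiff ℝ 1 (fun p : ℝ × ℝ => duhamelAlong κ σ φ S p.1 p.2) :=
    contDiff_one_of_partials (hasDerivAt_duhamelAlong_time hS)
      (hasDerivAt_duhamelAlong_space hφ hS hS' hd) (continuous_duhamel_integrand hS)
      (continuous_duhamelAlong hφ' hS')
  set y := x - σ * t with hy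
  have hF := (h.differentiable one_ne_zero (t, y)).hasFDerivAt
  set F := fderiv ℝ (fun p : ℝ × ℝ => duhamelAlong κ σ φ S p.1 p.2) (t, y) with hFdef
  have e1 : F (1, 0) = κ * Real.exp (κ * t) * S t (y + σ * t) := by
    have := hF.comp_hasDerivAt t ((hasDerivAt_id t).prodMk (hasDerivAt_const t y))
    exact this.unique (hasDerivAt_duhamelAlong_time hS t y)
  have e2 : F (0, 1) = duhamelAlong κ σ φ' S' t y := by
    have := hF.comp_hasDerivAt y ((hasDerivAt_const y t).prodMk (hasDerivAt_id y))
    exact this.unique (hasDerivAt_duhamelAlong_space hφ hS hS' hd t y)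
  have e3 : HasDerivAt (fun τ => duhamelAlong κ σ φ S τ (x - σ * τ)) (F (1, -σ)) t := by
    have hl : HasDerivAt (fun τ : ℝ => x - σ * τ) (-σ) t := by
      simpa using! ((hasDerivAt_id t).const_mul σ).const_sub x
    exact hF.comp_hasDerivAt t ((hasDerivAt_id t).prodMk hl)
  have e4 : F (1, -σ) = F (1, 0) - σ * F (0, 1) := by
    have : ((1, -σ) : ℝ × ℝ) = (1, 0) - σ • (0, 1) := by simp
    rw [this, map_sub, map_smul, smul_eq_mul]
  have e5 : HasDerivAt (fun τ => Real.exp (-(κ * τ))) (Real.exp (-(κ * t)) * -κ) t := by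
    simpa using! (((hasDerivAt_id t).const_mul κ).neg).exp
  have e6 := (e5.mul e3).deriv
  have e7 := (hasDerivAt_duhamel_space (κ := κ) (σ := σ) hφ hS hS' hd t x).deriv
  have e8 : deriv (fun τ => duhamel κ σ φ S τ x) t = _ := e6
  rw [e7, e8, e4, e1, e2]
  simp only [duhamel, ← hy]
  have : y + σ * t = x := by rw [hy]; ring
  rw [this]
  have hexp : Real.exp (-(κ * t)) * Real.exp (κ * t) = 1 := by rw [← Real.exp_add]; simp
  linear_combination (κ * S t x) * hexp

theorem duhamel_zero (x : ℝ) : duhamel κ σ φ S 0 x = φ x := by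
  simp [duhamel, duhamelAlong]

theorem duhamel_sub {ψ : ℝ → ℝ} {R : ℝ → ℝ → ℝ} (hS : Continuous (Function.uncurry S))
    (hR : Continuous (Function.uncurry R)) (t x : ℝ) :
    duhamel κ σ φ S t x - duhamel κ σ ψ R t x =
      duhamel κ σ (fun y => φ y - ψ y) (fun s y => S s y - R s y) t x := by
  simp only [duhamel, duhamelAlong]
  rw [← mul_sub, add_sub_add_comm, ← intervalIntegral.integral_sub
    ((continuous_duhamel_integrand_left hS _).intervalIntegrable _ _)
    ((continuous_duhamel_integrand_left hR _).intervalIntegrable _ _)]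
  simp only [mul_sub]

theorem integral_mul_exp (κ γ t : ℝ) (h : κ + γ ≠ 0) (B : ℝ) :
    ∫ s in 0..t, κ * Real.exp (κ * s) * (B * Real.exp (γ * s)) =
      κ / (κ + γ) * B * (Real.exp ((κ + γ) * t) - 1) := by
  have h1 : ∀ s : ℝ, κ * Real.exp (κ * s) * (B * Real.exp (γ * s)) =
      κ * B * Real.exp ((κ + γ) * s) := fun s => by
    rw [add_mul, Real.exp_add]; ring
  simp_rw [h1]
  rw [intervalIntegral.integral_const_mul, intervalIntegral.integral_comp_mul_left _ h]
  simp
  field_simp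

/-- Comparison with the explicit solution for a right-hand side `B exp (γ t)`. -/
theorem duhamel_le (hκ : 0 < κ) {γ : ℝ} (hγ : 0 ≤ γ) {A B : ℝ}
    (hS : Continuous (Function.uncurry S)) (hφA : ∀ x, φ x ≤ A) {t : ℝ} (ht : 0 ≤ t)
    (hSB : ∀ s ∈ Set.Icc 0 t, ∀ x, S s x ≤ B * Real.exp (γ * s)) (x : ℝ) :
    duhamel κ σ φ S t x ≤
      Real.exp (-(κ * t)) * (A + κ / (κ + γ) * B * (Real.exp ((κ + γ) * t) - 1)) := by
  unfold duhamel duhamelAlong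
  gcongr
  · exact hφA _
  rw [← integral_mul_exp κ γ t (by positivity) B]
  apply intervalIntegral.integral_mono_on ht
    ((continuous_duhamel_integrand_left hS _).intervalIntegrable _ _)
  · exact (by fun_prop : Continuous fun s => κ * Real.exp (κ * s) * (B * Real.exp (γ * s))
      ).intervalIntegrable _ _
  · intro s hs
    gcongr
    exact hSB s hs _

theorem duhamel_neg : duhamel κ σ (fun x => -φ x) (fun s x => -S s x) =
    fun t x => -duhamel κ σ φ S t x := by
  ext t x
  simp only [duhamel, duhamelAlong, mul_neg, intervalIntegral.integral_neg]
  ring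

/-- Maximum principle: the solution is a weighted average of the datum and of earlier source values,
with total weight 1. -/
theorem duhamel_le_const (hκ : 0 < κ) {A : ℝ}
    (hS : Continuous (Function.uncurry S)) (hφA : ∀ x, φ x ≤ A) {t : ℝ} (ht : 0 ≤ t)
    (hSA : ∀ s ∈ Set.Icc 0 t, ∀ x, S s x ≤ A) (x : ℝ) : duhamel κ σ φ S t x ≤ A := by
  have h := duhamel_le (σ := σ) hκ le_rfl hS hφA ht (B := A) (by simpa using hSA) x
  refine h.trans (le_of_eq ?_)
  have hexp : Real.exp (-(κ * t)) * Real.exp (κ * t) = 1 := by rw [← Real.exp_add]; simp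
  rw [add_zero, div_self hκ.ne']
  linear_combination A * hexp

theorem const_le_duhamel (hκ : 0 < κ) {A : ℝ}
    (hS : Continuous (Function.uncurry S)) (hφA : ∀ x, A ≤ φ x) {t : ℝ} (ht : 0 ≤ t)
    (hSA : ∀ s ∈ Set.Icc 0 t, ∀ x, A ≤ S s x) (x : ℝ) : A ≤ duhamel κ σ φ S t x := by
  have h := duhamel_le_const (κ := κ) (σ := σ) (φ := fun x => -φ x) (S := fun s x => -S s x)
    (A := -A) hκ hS.neg (fun x => neg_le_neg (hφA x)) ht
    (fun s hs x => neg_le_neg (hSA s hs x)) x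
  rw [duhamel_neg] at h
  linarith

/-- The point is the factor κ/(κ + γ): measured in the weight exp(γt), the source is damped as much
as desired once γ is large compared with κ. -/
theorem abs_duhamel_le (hκ : 0 < κ) {γ : ℝ} (hγ : 0 ≤ γ) {A B : ℝ} (hB : 0 ≤ B)
    (hS : Continuous (Function.uncurry S)) (hφA : ∀ x, |φ x| ≤ A) {t : ℝ} (ht : 0 ≤ t)
    (hSB : ∀ s ∈ Set.Icc 0 t, ∀ x, |S s x| ≤ B * Real.exp (γ * s)) (x : ℝ) :
    |duhamel κ σ φ S t x| ≤ A + κ / (κ + γ) * B * Real.exp (γ * t) := by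
  have hA : 0 ≤ A := (abs_nonneg _).trans (hφA 0)
  have key : Real.exp (-(κ * t)) * (A + κ / (κ + γ) * B * (Real.exp ((κ + γ) * t) - 1)) ≤
      A + κ / (κ + γ) * B * Real.exp (γ * t) := by
    have h1 : Real.exp (-(κ * t)) ≤ 1 := Real.exp_le_one_iff.2 (by nlinarith)
    have h2 : Real.exp (-(κ * t)) * Real.exp ((κ + γ) * t) = Real.exp (γ * t) := by
      rw [← Real.exp_add]; ring_nf
    have h3 : 0 ≤ κ / (κ + γ) * B := by positivity
    have h4 := Real.exp_pos (-(κ * t))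
    calc _ = Real.exp (-(κ * t)) * A + κ / (κ + γ) * B * Real.exp (γ * t)
          - Real.exp (-(κ * t)) * (κ / (κ + γ) * B) := by rw [← h2]; ring
      _ ≤ _ := by nlinarith [mul_le_mul_of_nonneg_right h1 hA, mul_nonneg h4.le h3]
  rw [abs_le]
  constructor
  · have h := duhamel_le (κ := κ) (σ := σ) (φ := fun x => -φ x) (S := fun s x => -S s x) hκ hγ
      hS.neg (fun x => (neg_le_abs _).trans (hφA x)) ht
      (fun s hs x => (neg_le_abs _).trans (hSB s hs x)) x
    rw [duhamel_neg] at h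
    linarith
  · exact (duhamel_le hκ hγ hS (fun x => (le_abs_self _).trans (hφA x)) ht
      (fun s hs x => (le_abs_self _).trans (hSB s hs x)) x).trans key

end Duhamel

/-! ### Picard iteration for the two-speed relaxation system -/

/-- The bounds are uniform in x and locally uniform in t, so the limit is continuous; the factor 2
sums the geometric series. The weight contains `max t 0` because the iterates are frozen at their
initial value for negative times. -/
theorem exists_limit_of_geometric (w : ℕ → ℝ → ℝ → ℝ)
    (hc : ∀ n, Continuous (Function.uncurry (w n))) {A γ : ℝ} (hA : 0 ≤ A) (hγ : 0 ≤ γ)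
    (h : ∀ n t x, |w (n + 1) t x - w n t x| ≤ A * (1 / 2) ^ n * Real.exp (γ * max t 0)) :
    ∃ W : ℝ → ℝ → ℝ, Continuous (Function.uncurry W) ∧
      ∀ n t x, |w n t x - W t x| ≤ 2 * A * Real.exp (γ * max t 0) * (1 / 2) ^ n := by
  have hd : ∀ t x n, dist (w n t x) (w (n + 1) t x) ≤ A * Real.exp (γ * max t 0) * (1 / 2) ^ n := by
    intro t x n
    rw [dist_comm, Real.dist_eq]
    exact (h n t x).trans (le_of_eq (by ring))
  have hlim : ∀ t x, ∃ l, Filter.Tendsto (fun n => w n t x) Filter.atTop (nhds l) := fun t x =>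
    cauchySeq_tendsto_of_complete
      (cauchySeq_of_le_geometric (1 / 2) _ (by norm_num) (hd t x))
  choose W hW using hlim
  have hbound : ∀ n t x, |w n t x - W t x| ≤ 2 * A * Real.exp (γ * max t 0) * (1 / 2) ^ n := by
    intro n t x
    have := dist_le_of_le_geometric_of_tendsto (1 / 2) _ (by norm_num) (hd t x) (hW t x) n
    rw [Real.dist_eq] at this
    refine this.trans (le_of_eq ?_)
    ring
  refine ⟨W, ?_, hbound⟩
  have hloc : TendstoLocallyUniformly (fun n => Function.uncurry (w n)) (Function.uncurry W)
      Filter.atTop := by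
    rw [Metric.tendstoLocallyUniformly_iff]
    intro ε hε p
    refine ⟨{q | q.1 < p.1 + 1}, ?_, ?_⟩
    · exact (isOpen_lt continuous_fst continuous_const).mem_nhds (by simp)
    have ht : Filter.Tendsto (fun n : ℕ => 2 * A * Real.exp (γ * max (p.1 + 1) 0) * (1 / 2) ^ n)
        Filter.atTop (nhds 0) := by
      simpa using! (tendsto_pow_atTop_nhds_zero_of_lt_one (r := (1 / 2 : ℝ)) (by norm_num)
        (by norm_num)).const_mul (2 * A * Real.exp (γ * max (p.1 + 1) 0))
    filter_upwards [ht.eventually_lt_const hε] with n hn q hq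
    rw [dist_comm, Real.dist_eq]
    refine ((hbound n q.1 q.2).trans ?_).trans_lt hn
    have : q.1 ≤ p.1 + 1 := le_of_lt hq
    gcongr
  exact hloc.continuous (Filter.Frequently.of_forall hc)

/-- Sum at the time `max t 0` of two solutions of damped transport equations with opposite
velocities. -/
noncomputable def duhamelPair (κ c : ℝ) (φ₁ φ₂ : ℝ → ℝ) (S₁ S₂ : ℝ → ℝ → ℝ) (t x : ℝ) : ℝ :=
  duhamel κ c φ₁ S₁ (max t 0) x + duhamel κ (-c) φ₂ S₂ (max t 0) x

section DuhamelPair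

variable {κ c : ℝ} {φ₁ φ₂ φ₁' φ₂' : ℝ → ℝ} {S₁ S₂ S₁' S₂' : ℝ → ℝ → ℝ}

theorem continuous_duhamelPair (hφ₁ : Continuous φ₁) (hφ₂ : Continuous φ₂)
    (hS₁ : Continuous (Function.uncurry S₁)) (hS₂ : Continuous (Function.uncurry S₂)) :
    Continuous (Function.uncurry (duhamelPair κ c φ₁ φ₂ S₁ S₂)) := by
  have hm : Continuous fun p : ℝ × ℝ => (max p.1 0, p.2) := by fun_prop
  exact ((continuous_duhamel hφ₁ hS₁).comp hm).add ((continuous_duhamel hφ₂ hS₂).comp hm)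

theorem hasDerivAt_duhamelPair (hφ₁ : ∀ x, HasDerivAt φ₁ (φ₁' x) x)
    (hφ₂ : ∀ x, HasDerivAt φ₂ (φ₂' x) x)
    (hS₁ : Continuous (Function.uncurry S₁)) (hS₂ : Continuous (Function.uncurry S₂))
    (hS₁' : Continuous (Function.uncurry S₁')) (hS₂' : Continuous (Function.uncurry S₂'))
    (hd₁ : ∀ t x, HasDerivAt (fun y => S₁ t y) (S₁' t x) x)
    (hd₂ : ∀ t x, HasDerivAt (fun y => S₂ t y) (S₂' t x) x) (t x : ℝ) :
    HasDerivAt (fun y => duhamelPair κ c φ₁ φ₂ S₁ S₂ t y)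
      (duhamelPair κ c φ₁' φ₂' S₁' S₂' t x) x :=
  (hasDerivAt_duhamel_space hφ₁ hS₁ hS₁' hd₁ _ x).add
    (hasDerivAt_duhamel_space hφ₂ hS₂ hS₂' hd₂ _ x)

theorem abs_duhamelPair_le (hκ : 0 < κ) {γ : ℝ} (hγ : 0 ≤ γ) {A B : ℝ} (hB : 0 ≤ B)
    (hS₁ : Continuous (Function.uncurry S₁)) (hS₂ : Continuous (Function.uncurry S₂))
    (hφ₁ : ∀ x, |φ₁ x| ≤ A) (hφ₂ : ∀ x, |φ₂ x| ≤ A)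
    (hB₁ : ∀ s x, 0 ≤ s → |S₁ s x| ≤ B * Real.exp (γ * s))
    (hB₂ : ∀ s x, 0 ≤ s → |S₂ s x| ≤ B * Real.exp (γ * s)) (t x : ℝ) :
    |duhamelPair κ c φ₁ φ₂ S₁ S₂ t x| ≤
      2 * A + 2 * (κ / (κ + γ)) * B * Real.exp (γ * max t 0) := by
  have h₁ := abs_duhamel_le (σ := c) hκ hγ hB hS₁ hφ₁ (le_max_right t 0)
    (fun s hs x => hB₁ s x hs.1) x
  have h₂ := abs_duhamel_le (σ := -c) hκ hγ hB hS₂ hφ₂ (le_max_right t 0)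
    (fun s hs x => hB₂ s x hs.1) x
  unfold duhamelPair
  refine (abs_add_le _ _).trans ((add_le_add h₁ h₂).trans (le_of_eq (by ring)))

theorem abs_duhamelPair_sub_le (hκ : 0 < κ) {γ : ℝ} (hγ : 0 ≤ γ) {B : ℝ} (hB : 0 ≤ B)
    (hS₁ : Continuous (Function.uncurry S₁)) (hS₂ : Continuous (Function.uncurry S₂))
    (hS₁' : Continuous (Function.uncurry S₁')) (hS₂' : Continuous (Function.uncurry S₂'))
    (hB₁ : ∀ s x, 0 ≤ s → |S₁ s x - S₁' s x| ≤ B * Real.exp (γ * s))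
    (hB₂ : ∀ s x, 0 ≤ s → |S₂ s x - S₂' s x| ≤ B * Real.exp (γ * s)) (t x : ℝ) :
    |duhamelPair κ c φ₁ φ₂ S₁ S₂ t x - duhamelPair κ c φ₁ φ₂ S₁' S₂' t x| ≤
      2 * (κ / (κ + γ)) * B * Real.exp (γ * max t 0) := by
  have h : duhamelPair κ c φ₁ φ₂ S₁ S₂ t x - duhamelPair κ c φ₁ φ₂ S₁' S₂' t x =
      duhamelPair κ c (fun y => φ₁ y - φ₁ y) (fun y => φ₂ y - φ₂ y)
        (fun s y => S₁ s y - S₁' s y) (fun s y => S₂ s y - S₂' s y) t x := by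
    unfold duhamelPair
    rw [← duhamel_sub hS₁ hS₁', ← duhamel_sub hS₂ hS₂']
    ring
  rw [h]
  have := abs_duhamelPair_le (c := c) (φ₁ := fun y => φ₁ y - φ₁ y) (φ₂ := fun y => φ₂ y - φ₂ y)
    (S₁ := fun s y => S₁ s y - S₁' s y) (S₂ := fun s y => S₂ s y - S₂' s y) hκ hγ (A := 0) hB (hS₁.sub hS₁') (hS₂.sub hS₂') (by simp) (by simp) hB₁ hB₂ t x
  simpa using this

end DuhamelPair

/-- `N` is a `C¹` function with derivative `N'`, where `0 ≤ N' ≤ 1` and `N'` is `Λ`-Lipschitz on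
`[-k, k]`. -/
structure IsMonotoneResponse (k Λ : ℝ) (N N' : ℝ → ℝ) : Prop where
  hasDerivAt : ∀ v, HasDerivAt N (N' v) v
  continuous_deriv : Continuous N'
  deriv_nonneg : ∀ v ∈ Set.Icc (-k) k, 0 ≤ N' v
  deriv_le_one : ∀ v ∈ Set.Icc (-k) k, N' v ≤ 1
  deriv_lipschitz : ∀ v ∈ Set.Icc (-k) k, ∀ w ∈ Set.Icc (-k) k, |N' v - N' w| ≤ Λ * |v - w|

namespace IsMonotoneResponse

variable {k Λ : ℝ} {N N' : ℝ → ℝ}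

theorem continuous (h : IsMonotoneResponse k Λ N N') : Continuous N :=
  continuous_iff_continuousAt.2 fun v => (h.hasDerivAt v).continuousAt

theorem monotoneOn (h : IsMonotoneResponse k Λ N N') : MonotoneOn N (Set.Icc (-k) k) :=
  monotoneOn_of_hasDerivWithinAt_nonneg (convex_Icc _ _) h.continuous.continuousOn
    (fun v _ => (h.hasDerivAt v).hasDerivWithinAt)
    (fun v hv => h.deriv_nonneg v (interior_subset hv))

theorem abs_deriv_le (h : IsMonotoneResponse k Λ N N') {v : ℝ} (hv : v ∈ Set.Icc (-k) k) :
    |N' v| ≤ 1 := abs_le.2 ⟨by linarith [h.deriv_nonneg v hv], h.deriv_le_one v hv⟩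

theorem abs_sub_le (h : IsMonotoneResponse k Λ N N') {v w : ℝ} (hv : v ∈ Set.Icc (-k) k)
    (hw : w ∈ Set.Icc (-k) k) : |N v - N w| ≤ |v - w| := by
  have := (convex_Icc (-k) k).norm_image_sub_le_of_norm_hasDerivWithin_le
    (f := N) (f' := N') (C := 1) (fun v _ => (h.hasDerivAt v).hasDerivWithinAt)
    (fun v hv => h.abs_deriv_le hv) hw hv
  simpa using this

theorem mem_Icc (h : IsMonotoneResponse k Λ N N') (hk : 0 ≤ k) {v : ℝ}
    (hv : v ∈ Set.Icc (-k) k) : N (-k) ≤ N v ∧ N v ≤ N k :=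
  ⟨h.monotoneOn ⟨le_rfl, by linarith⟩ hv hv.1, h.monotoneOn hv ⟨by linarith, le_rfl⟩ hv.2⟩

end IsMonotoneResponse

/-- Picard iterates for the sum `u = f₁ + f₂` of the solutions of
`∂ₜ f₁ + c ∂ₓ f₁ = κ (N₁ u - f₁)`, `∂ₜ f₂ - c ∂ₓ f₂ = κ (N₂ u - f₂)`. -/
noncomputable def picardIter (κ c : ℝ) (φ₁ φ₂ N₁ N₂ : ℝ → ℝ) : ℕ → ℝ → ℝ → ℝ
  | 0 => fun _ _ => 0
  | n + 1 => duhamelPair κ c φ₁ φ₂ (fun s y => N₁ (picardIter κ c φ₁ φ₂ N₁ N₂ n s y))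
      (fun s y => N₂ (picardIter κ c φ₁ φ₂ N₁ N₂ n s y))

/-- Picard iterates for the linear system satisfied by the space derivative, along iterates `u`. -/
noncomputable def picardIterDeriv (κ c : ℝ) (φ₁' φ₂' N₁' N₂' : ℝ → ℝ) (u : ℕ → ℝ → ℝ → ℝ) :
    ℕ → ℝ → ℝ → ℝ
  | 0 => fun _ _ => 0
  | n + 1 => duhamelPair κ c φ₁' φ₂'
      (fun s y => N₁' (u n s y) * picardIterDeriv κ c φ₁' φ₂' N₁' N₂' u n s y)
      (fun s y => N₂' (u n s y) * picardIterDeriv κ c φ₁' φ₂' N₁' N₂' u n s y)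

section Picard

variable {κ c k Λ P : ℝ} {φ₁ φ₂ φ₁' φ₂' N₁ N₂ N₁' N₂' : ℝ → ℝ}

theorem continuous_picardIter (hφ₁ : Continuous φ₁) (hφ₂ : Continuous φ₂) (hN₁ : Continuous N₁)
    (hN₂ : Continuous N₂) (n : ℕ) :
    Continuous (Function.uncurry (picardIter κ c φ₁ φ₂ N₁ N₂ n)) := by
  induction n with
  | zero => exact continuous_const
  | succ n ih => exact continuous_duhamelPair hφ₁ hφ₂ (hN₁.comp ih) (hN₂.comp ih)

/-- The invariant region: monotone responses map [-k, k] into [Nᵢ(-k), Nᵢ(k)], the maximum principle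
keeps each component there, and N₁ + N₂ = id returns the sum to [-k, k]. -/
theorem duhamelPair_mem_Icc (hκ : 0 < κ) (hk : 0 ≤ k) (h₁ : IsMonotoneResponse k Λ N₁ N₁')
    (h₂ : IsMonotoneResponse k Λ N₂ N₂') (hsum : ∀ v, N₁ v + N₂ v = v)
    (hb₁ : ∀ x, φ₁ x ∈ Set.Icc (N₁ (-k)) (N₁ k)) (hb₂ : ∀ x, φ₂ x ∈ Set.Icc (N₂ (-k)) (N₂ k))
    {u : ℝ → ℝ → ℝ} (hu : Continuous (Function.uncurry u))
    (huk : ∀ t x, u t x ∈ Set.Icc (-k) k) (t x : ℝ) :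
    duhamelPair κ c φ₁ φ₂ (fun s y => N₁ (u s y)) (fun s y => N₂ (u s y)) t x ∈
      Set.Icc (-k) k := by
  have c₁ : Continuous (Function.uncurry fun s y => N₁ (u s y)) := h₁.continuous.comp hu
  have c₂ : Continuous (Function.uncurry fun s y => N₂ (u s y)) := h₂.continuous.comp hu
  have ht := le_max_right t 0
  have l₁ := const_le_duhamel (σ := c) hκ c₁ (fun x => (hb₁ x).1) ht
    (fun s _ x => (h₁.mem_Icc hk (huk s x)).1) x
  have l₂ := const_le_duhamel (σ := -c) hκ c₂ (fun x => (hb₂ x).1) ht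
    (fun s _ x => (h₂.mem_Icc hk (huk s x)).1) x
  have r₁ := duhamel_le_const (σ := c) hκ c₁ (fun x => (hb₁ x).2) ht
    (fun s _ x => (h₁.mem_Icc hk (huk s x)).2) x
  have r₂ := duhamel_le_const (σ := -c) hκ c₂ (fun x => (hb₂ x).2) ht
    (fun s _ x => (h₂.mem_Icc hk (huk s x)).2) x
  have e₁ := hsum k
  have e₂ := hsum (-k)
  constructor <;> unfold duhamelPair <;> linarith

theorem picardIter_mem_Icc (hκ : 0 < κ) (hk : 0 ≤ k) (hφ₁ : Continuous φ₁) (hφ₂ : Continuous φ₂)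
    (h₁ : IsMonotoneResponse k Λ N₁ N₁') (h₂ : IsMonotoneResponse k Λ N₂ N₂')
    (hsum : ∀ v, N₁ v + N₂ v = v)
    (hb₁ : ∀ x, φ₁ x ∈ Set.Icc (N₁ (-k)) (N₁ k)) (hb₂ : ∀ x, φ₂ x ∈ Set.Icc (N₂ (-k)) (N₂ k))
    (n : ℕ) (t x : ℝ) : picardIter κ c φ₁ φ₂ N₁ N₂ n t x ∈ Set.Icc (-k) k := by
  induction n generalizing t x with
  | zero => exact ⟨by simpa [picardIter] using hk, by simpa [picardIter] using hk⟩
  | succ n ih =>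
    exact duhamelPair_mem_Icc hκ hk h₁ h₂ hsum hb₁ hb₂
      (continuous_picardIter hφ₁ hφ₂ h₁.continuous h₂.continuous n) ih t x

/-- The responses are 1-Lipschitz, and with γ = 7κ each of the two components gains κ/(κ + 7κ) =
1/8; together they contract by 1/4. -/
theorem abs_duhamelPair_response_sub_le (hκ : 0 < κ)
    (h₁ : IsMonotoneResponse k Λ N₁ N₁') (h₂ : IsMonotoneResponse k Λ N₂ N₂')
    {u v : ℝ → ℝ → ℝ} (hu : Continuous (Function.uncurry u)) (hv : Continuous (Function.uncurry v))
    (huk : ∀ t x, u t x ∈ Set.Icc (-k) k) (hvk : ∀ t x, v t x ∈ Set.Icc (-k) k) {B : ℝ}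
    (hB : 0 ≤ B) (h : ∀ t x, |u t x - v t x| ≤ B * Real.exp (7 * κ * max t 0)) (t x : ℝ) :
    |duhamelPair κ c φ₁ φ₂ (fun s y => N₁ (u s y)) (fun s y => N₂ (u s y)) t x -
      duhamelPair κ c φ₁ φ₂ (fun s y => N₁ (v s y)) (fun s y => N₂ (v s y)) t x| ≤
      1 / 4 * B * Real.exp (7 * κ * max t 0) := by
  have hh : ∀ s x, 0 ≤ s → |u s x - v s x| ≤ B * Real.exp (7 * κ * s) := fun s x hs => by
    simpa [max_eq_left hs] using h s x
  have := abs_duhamelPair_sub_le (c := c) (φ₁ := φ₁) (φ₂ := φ₂)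
    (S₁ := fun s y => N₁ (u s y)) (S₂ := fun s y => N₂ (u s y))
    (S₁' := fun s y => N₁ (v s y)) (S₂' := fun s y => N₂ (v s y))
    hκ (γ := 7 * κ) (by positivity) hB
    (h₁.continuous.comp hu) (h₂.continuous.comp hu) (h₁.continuous.comp hv)
    (h₂.continuous.comp hv)
    (fun s x hs => (h₁.abs_sub_le (huk s x) (hvk s x)).trans (hh s x hs))
    (fun s x hs => (h₂.abs_sub_le (huk s x) (hvk s x)).trans (hh s x hs)) t x
  refine this.trans (le_of_eq ?_)
  have : κ / (κ + 7 * κ) = 1 / 8 := by field_simp; norm_num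
  rw [this]
  ring

theorem abs_picardIter_succ_sub_le (hκ : 0 < κ) (hk : 0 ≤ k)
    (hφ₁ : Continuous φ₁) (hφ₂ : Continuous φ₂)
    (h₁ : IsMonotoneResponse k Λ N₁ N₁') (h₂ : IsMonotoneResponse k Λ N₂ N₂')
    (hsum : ∀ v, N₁ v + N₂ v = v)
    (hb₁ : ∀ x, φ₁ x ∈ Set.Icc (N₁ (-k)) (N₁ k)) (hb₂ : ∀ x, φ₂ x ∈ Set.Icc (N₂ (-k)) (N₂ k))
    (n : ℕ) (t x : ℝ) :
    |picardIter κ c φ₁ φ₂ N₁ N₂ (n + 1) t x - picardIter κ c φ₁ φ₂ N₁ N₂ n t x| ≤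
      k * (1 / 4) ^ n * Real.exp (7 * κ * max t 0) := by
  have hm := picardIter_mem_Icc (c := c) hκ hk hφ₁ hφ₂ h₁ h₂ hsum hb₁ hb₂
  have hcont := continuous_picardIter (κ := κ) (c := c) hφ₁ hφ₂ h₁.continuous h₂.continuous
  induction n generalizing t x with
  | zero =>
    have h := abs_le.2 (hm 1 t x)
    have he : 1 ≤ Real.exp (7 * κ * max t 0) := Real.one_le_exp (by positivity)
    have h0 : picardIter κ c φ₁ φ₂ N₁ N₂ 0 t x = 0 := rfl
    rw [h0, sub_zero, pow_zero, mul_one]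
    exact h.trans (le_mul_of_one_le_right hk he)
  | succ n ih =>
    have := abs_duhamelPair_response_sub_le (c := c) (φ₁ := φ₁) (φ₂ := φ₂) hκ h₁ h₂
      (hcont (n + 1)) (hcont n) (hm (n + 1)) (hm n) (B := k * (1 / 4) ^ n) (by positivity) ih t x
    refine this.trans (le_of_eq ?_)
    rw [pow_succ]
    ring

theorem continuous_picardIterDeriv (hφ₁ : Continuous φ₁') (hφ₂ : Continuous φ₂')
    (hN₁ : Continuous N₁') (hN₂ : Continuous N₂') {u : ℕ → ℝ → ℝ → ℝ}
    (hu : ∀ n, Continuous (Function.uncurry (u n))) (n : ℕ) :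
    Continuous (Function.uncurry (picardIterDeriv κ c φ₁' φ₂' N₁' N₂' u n)) := by
  induction n with
  | zero => exact continuous_const
  | succ n ih =>
    exact continuous_duhamelPair hφ₁ hφ₂ ((hN₁.comp (hu n)).mul ih) ((hN₂.comp (hu n)).mul ih)

theorem hasDerivAt_picardIter (hφ₁ : ∀ x, HasDerivAt φ₁ (φ₁' x) x)
    (hφ₂ : ∀ x, HasDerivAt φ₂ (φ₂' x) x) (hφ₁' : Continuous φ₁') (hφ₂' : Continuous φ₂')
    (h₁ : IsMonotoneResponse k Λ N₁ N₁') (h₂ : IsMonotoneResponse k Λ N₂ N₂') (n : ℕ) (t x : ℝ) :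
    HasDerivAt (fun y => picardIter κ c φ₁ φ₂ N₁ N₂ n t y)
      (picardIterDeriv κ c φ₁' φ₂' N₁' N₂' (picardIter κ c φ₁ φ₂ N₁ N₂) n t x) x := by
  have cφ₁ : Continuous φ₁ := continuous_iff_continuousAt.2 fun v => (hφ₁ v).continuousAt
  have cφ₂ : Continuous φ₂ := continuous_iff_continuousAt.2 fun v => (hφ₂ v).continuousAt
  have hcont := continuous_picardIter (κ := κ) (c := c) cφ₁ cφ₂ h₁.continuous h₂.continuous
  have hcont' := continuous_picardIterDeriv (κ := κ) (c := c) hφ₁' hφ₂' h₁.continuous_deriv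
    h₂.continuous_deriv hcont
  induction n generalizing t x with
  | zero => exact hasDerivAt_const x 0
  | succ n ih =>
    exact hasDerivAt_duhamelPair (S₁ := fun s y => N₁ (picardIter κ c φ₁ φ₂ N₁ N₂ n s y))
      (S₂ := fun s y => N₂ (picardIter κ c φ₁ φ₂ N₁ N₂ n s y))
      (S₁' := fun s y => N₁' (picardIter κ c φ₁ φ₂ N₁ N₂ n s y) *
        picardIterDeriv κ c φ₁' φ₂' N₁' N₂' (picardIter κ c φ₁ φ₂ N₁ N₂) n s y)
      (S₂' := fun s y => N₂' (picardIter κ c φ₁ φ₂ N₁ N₂ n s y) *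
        picardIterDeriv κ c φ₁' φ₂' N₁' N₂' (picardIter κ c φ₁ φ₂ N₁ N₂) n s y) hφ₁ hφ₂ (h₁.continuous.comp (hcont n))
      (h₂.continuous.comp (hcont n)) ((h₁.continuous_deriv.comp (hcont n)).mul (hcont' n))
      ((h₂.continuous_deriv.comp (hcont n)).mul (hcont' n))
      (fun s y => (h₁.hasDerivAt _).comp y (ih s y)) (fun s y => (h₂.hasDerivAt _).comp y (ih s y))
      t x

/-- The recursion is linear with coefficients of modulus at most 1. The constant 4P closes the
induction, since 2P + (1/4)(4P)e ≤ 4Pe for e ≥ 1. -/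
theorem abs_picardIterDeriv_le (hκ : 0 < κ) (hφ₁' : Continuous φ₁') (hφ₂' : Continuous φ₂')
    (h₁ : IsMonotoneResponse k Λ N₁ N₁') (h₂ : IsMonotoneResponse k Λ N₂ N₂')
    (hP₁ : ∀ x, |φ₁' x| ≤ P) (hP₂ : ∀ x, |φ₂' x| ≤ P) {u : ℕ → ℝ → ℝ → ℝ}
    (hu : ∀ n, Continuous (Function.uncurry (u n)))
    (huk : ∀ n t x, u n t x ∈ Set.Icc (-k) k) (n : ℕ) (t x : ℝ) :
    |picardIterDeriv κ c φ₁' φ₂' N₁' N₂' u n t x| ≤ 4 * P * Real.exp (7 * κ * max t 0) := by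
  have hP : 0 ≤ P := (abs_nonneg _).trans (hP₁ 0)
  induction n generalizing t x with
  | zero => simp [picardIterDeriv]; positivity
  | succ n ih =>
    have hcont' := continuous_picardIterDeriv (κ := κ) (c := c) hφ₁' hφ₂' h₁.continuous_deriv
      h₂.continuous_deriv hu n
    have hb : ∀ {N N' : ℝ → ℝ}, IsMonotoneResponse k Λ N N' → ∀ s y, 0 ≤ s →
        |N' (u n s y) * picardIterDeriv κ c φ₁' φ₂' N₁' N₂' u n s y| ≤
          4 * P * Real.exp (7 * κ * s) := by
      intro N N' h s y hs
      rw [abs_mul]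
      have := ih s y
      rw [max_eq_left hs] at this
      calc _ ≤ 1 * (4 * P * Real.exp (7 * κ * s)) := by
            gcongr
            exact h.abs_deriv_le (huk n s y)
        _ = _ := one_mul _
    have := abs_duhamelPair_le (c := c)
      (S₁ := fun s y => N₁' (u n s y) * picardIterDeriv κ c φ₁' φ₂' N₁' N₂' u n s y)
      (S₂ := fun s y => N₂' (u n s y) * picardIterDeriv κ c φ₁' φ₂' N₁' N₂' u n s y) hκ (γ := 7 * κ) (by positivity) (B := 4 * P) (by positivity)
      ((h₁.continuous_deriv.comp (hu n)).mul hcont')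
      ((h₂.continuous_deriv.comp (hu n)).mul hcont') hP₁ hP₂ (hb h₁) (hb h₂) t x
    refine this.trans ?_
    have e : κ / (κ + 7 * κ) = 1 / 8 := by field_simp; norm_num
    have he : 1 ≤ Real.exp (7 * κ * max t 0) := Real.one_le_exp (by positivity)
    rw [e]
    nlinarith [mul_nonneg hP (sub_nonneg.2 he)]

/-- The coefficients also change from step to step. This contributes (N'(uₙ₊₁) - N'(uₙ)) qₙ, a
product of two quantities of growth exp(7κt), hence the weight exp(14κt). -/
theorem abs_picardIterDeriv_succ_sub_le (hκ : 0 < κ) (hk : 0 ≤ k) (hΛ : 0 ≤ Λ)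
    (hφ₁' : Continuous φ₁') (hφ₂' : Continuous φ₂')
    (h₁ : IsMonotoneResponse k Λ N₁ N₁') (h₂ : IsMonotoneResponse k Λ N₂ N₂')
    (hP₁ : ∀ x, |φ₁' x| ≤ P) (hP₂ : ∀ x, |φ₂' x| ≤ P) {u : ℕ → ℝ → ℝ → ℝ}
    (hu : ∀ n, Continuous (Function.uncurry (u n)))
    (huk : ∀ n t x, u n t x ∈ Set.Icc (-k) k)
    (hd : ∀ n t x, |u (n + 1) t x - u n t x| ≤ k * (1 / 4) ^ n * Real.exp (7 * κ * max t 0))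
    (n : ℕ) (t x : ℝ) :
    |picardIterDeriv κ c φ₁' φ₂' N₁' N₂' u (n + 1) t x -
      picardIterDeriv κ c φ₁' φ₂' N₁' N₂' u n t x| ≤
      (4 * P + 4 * (Λ * k * P)) * (1 / 2) ^ n * Real.exp (14 * κ * max t 0) := by
  have hP : 0 ≤ P := (abs_nonneg _).trans (hP₁ 0)
  have hbd := abs_picardIterDeriv_le (c := c) hκ hφ₁' hφ₂' h₁ h₂ hP₁ hP₂ hu huk
  have hcont' := continuous_picardIterDeriv (κ := κ) (c := c) hφ₁' hφ₂' h₁.continuous_deriv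
      h₂.continuous_deriv hu
  set q := picardIterDeriv κ c φ₁' φ₂' N₁' N₂' u with hq
  induction n generalizing t x with
  | zero =>
    have h0 : q 0 t x = 0 := rfl
    rw [h0, sub_zero, pow_zero, mul_one]
    refine (hbd 1 t x).trans ?_
    have : 0 ≤ κ * max t 0 := by positivity
    gcongr
    · nlinarith [mul_nonneg (mul_nonneg hΛ hk) hP]
    · norm_num
  | succ n ih =>
    have hb : ∀ {N N' : ℝ → ℝ}, IsMonotoneResponse k Λ N N' → ∀ s y, 0 ≤ s →
        |N' (u (n + 1) s y) * q (n + 1) s y - N' (u n s y) * q n s y| ≤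
          ((4 * P + 4 * (Λ * k * P)) * (1 / 2) ^ n + 4 * (Λ * k * P) * (1 / 4) ^ n)
            * Real.exp (14 * κ * s) := by
      intro N N' h s y hs
      have i1 := ih s y
      have i2 := hbd n s y
      have i3 := hd n s y
      rw [max_eq_left hs] at i1 i2 i3
      have i4 := h.deriv_lipschitz _ (huk (n + 1) s y) _ (huk n s y)
      have i5 := h.abs_deriv_le (huk (n + 1) s y)
      have e : Real.exp (14 * κ * s) = Real.exp (7 * κ * s) * Real.exp (7 * κ * s) := by
        rw [← Real.exp_add]; ring_nf
      have split : N' (u (n + 1) s y) * q (n + 1) s y - N' (u n s y) * q n s y =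
          N' (u (n + 1) s y) * (q (n + 1) s y - q n s y) +
            (N' (u (n + 1) s y) - N' (u n s y)) * q n s y := by ring
      rw [split]
      calc _ ≤ |N' (u (n + 1) s y)| * |q (n + 1) s y - q n s y| +
            |N' (u (n + 1) s y) - N' (u n s y)| * |q n s y| := by
              rw [← abs_mul, ← abs_mul]; exact abs_add_le _ _
        _ ≤ 1 * ((4 * P + 4 * (Λ * k * P)) * (1 / 2) ^ n * Real.exp (14 * κ * s)) +
            (Λ * (k * (1 / 4) ^ n * Real.exp (7 * κ * s))) *
              (4 * P * Real.exp (7 * κ * s)) := by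
              gcongr
              exact i4.trans (by gcongr)
        _ = _ := by rw [e]; ring
    have := abs_duhamelPair_sub_le (c := c) (φ₁ := φ₁') (φ₂ := φ₂')
      (S₁ := fun s y => N₁' (u (n + 1) s y) * q (n + 1) s y)
      (S₂ := fun s y => N₂' (u (n + 1) s y) * q (n + 1) s y)
      (S₁' := fun s y => N₁' (u n s y) * q n s y) (S₂' := fun s y => N₂' (u n s y) * q n s y)
      hκ (γ := 14 * κ)
      (by positivity)
      (B := (4 * P + 4 * (Λ * k * P)) * (1 / 2) ^ n + 4 * (Λ * k * P) * (1 / 4) ^ n)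
      (by positivity)
      ((h₁.continuous_deriv.comp (hu (n + 1))).mul (hcont' (n + 1)))
      ((h₂.continuous_deriv.comp (hu (n + 1))).mul (hcont' (n + 1)))
      ((h₁.continuous_deriv.comp (hu n)).mul (hcont' n))
      ((h₂.continuous_deriv.comp (hu n)).mul (hcont' n))
      (hb h₁) (hb h₂) t x
    refine this.trans ?_
    -- With E = 4P + 4ΛkP, the induction closes because (2/15)(E + 4ΛkP) ≤ E/2.
    have e : κ / (κ + 14 * κ) = 1 / 15 := by field_simp; norm_num
    rw [e]
    have hpow : (1 / 4 : ℝ) ^ n ≤ (1 / 2) ^ n := by gcongr; norm_num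
    refine mul_le_mul_of_nonneg_right ?_ (Real.exp_pos _).le
    rw [pow_succ]
    have : 0 ≤ 4 * (Λ * k * P) := by positivity
    have h2 : (0 : ℝ) ≤ (1 / 2) ^ n := by positivity
    nlinarith [mul_nonneg this (sub_nonneg.2 hpow), mul_nonneg this h2, mul_nonneg hP h2]

/-- Global existence of a classical solution of a two-speed relaxation system whose Maxwellians
are nondecreasing on `[-k, k]`, for data between the equilibria of `-k` and `k`. -/
theorem exists_relaxation_solution (hκ : 0 < κ) (hk : 0 ≤ k) (hΛ : 0 ≤ Λ)
    (hφ₁ : ∀ x, HasDerivAt φ₁ (φ₁' x) x) (hφ₂ : ∀ x, HasDerivAt φ₂ (φ₂' x) x)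
    (hφ₁' : Continuous φ₁') (hφ₂' : Continuous φ₂')
    (h₁ : IsMonotoneResponse k Λ N₁ N₁') (h₂ : IsMonotoneResponse k Λ N₂ N₂')
    (hsum : ∀ v, N₁ v + N₂ v = v)
    (hb₁ : ∀ x, φ₁ x ∈ Set.Icc (N₁ (-k)) (N₁ k)) (hb₂ : ∀ x, φ₂ x ∈ Set.Icc (N₂ (-k)) (N₂ k))
    (hP₁ : ∀ x, |φ₁' x| ≤ P) (hP₂ : ∀ x, |φ₂' x| ≤ P) :
    ∃ f₁ f₂ : ℝ → ℝ → ℝ,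
      ContDiff ℝ 1 (fun p : ℝ × ℝ => f₁ p.1 p.2) ∧ ContDiff ℝ 1 (fun p : ℝ × ℝ => f₂ p.1 p.2) ∧
      (∀ x, f₁ 0 x = φ₁ x) ∧ (∀ x, f₂ 0 x = φ₂ x) ∧
      (∀ t x, 0 ≤ t → deriv (fun τ => f₁ τ x) t + c * deriv (fun y => f₁ t y) x =
        κ * (N₁ (f₁ t x + f₂ t x) - f₁ t x)) ∧
      (∀ t x, 0 ≤ t → deriv (fun τ => f₂ τ x) t + -c * deriv (fun y => f₂ t y) x =
        κ * (N₂ (f₁ t x + f₂ t x) - f₂ t x)) ∧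
      (∀ t x, 0 ≤ t → f₁ t x ∈ Set.Icc (N₁ (-k)) (N₁ k) ∧ f₂ t x ∈ Set.Icc (N₂ (-k)) (N₂ k)) := by
  have cφ₁ : Continuous φ₁ := continuous_iff_continuousAt.2 fun v => (hφ₁ v).continuousAt
  have cφ₂ : Continuous φ₂ := continuous_iff_continuousAt.2 fun v => (hφ₂ v).continuousAt
  have hP : 0 ≤ P := (abs_nonneg _).trans (hP₁ 0)
  have hcont := continuous_picardIter (κ := κ) (c := c) cφ₁ cφ₂ h₁.continuous h₂.continuous
  have hm := picardIter_mem_Icc (c := c) hκ hk cφ₁ cφ₂ h₁ h₂ hsum hb₁ hb₂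
  have hd := abs_picardIter_succ_sub_le (c := c) hκ hk cφ₁ cφ₂ h₁ h₂ hsum hb₁ hb₂
  have hder := hasDerivAt_picardIter (κ := κ) (c := c) hφ₁ hφ₂ hφ₁' hφ₂' h₁ h₂
  set un := picardIter κ c φ₁ φ₂ N₁ N₂ with hun
  have hcont' := continuous_picardIterDeriv (κ := κ) (c := c) hφ₁' hφ₂' h₁.continuous_deriv
    h₂.continuous_deriv hcont
  have hd' := abs_picardIterDeriv_succ_sub_le (c := c) hκ hk hΛ hφ₁' hφ₂' h₁ h₂ hP₁ hP₂ hcont hm hd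
  set qn := picardIterDeriv κ c φ₁' φ₂' N₁' N₂' un with hqn
  obtain ⟨u, hu, hub⟩ := exists_limit_of_geometric un hcont (A := k) (γ := 7 * κ) hk
    (by positivity) (fun n t x => (hd n t x).trans (by gcongr; norm_num))
  obtain ⟨q, hq, hqb⟩ := exists_limit_of_geometric qn hcont' (A := 4 * P + 4 * (Λ * k * P))
    (γ := 14 * κ) (by positivity) (by positivity) hd'
  have hpow : ∀ B : ℝ, Filter.Tendsto (fun n : ℕ => B * (1 / 2) ^ n) Filter.atTop (nhds 0) := by
    intro B
    simpa using! (tendsto_pow_atTop_nhds_zero_of_lt_one (r := (1 / 2 : ℝ)) (by norm_num)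
        (by norm_num)).const_mul B
  have hlim : ∀ t x, Filter.Tendsto (fun n => un n t x) Filter.atTop (nhds (u t x)) := by
    intro t x
    rw [tendsto_iff_dist_tendsto_zero]
    exact squeeze_zero (fun _ => dist_nonneg) (fun n => hub n t x) (hpow _)
  have huk : ∀ t x, u t x ∈ Set.Icc (-k) k := fun t x =>
    isClosed_Icc.mem_of_tendsto (hlim t x) (Filter.Eventually.of_forall fun n => hm n t x)
  -- For fixed t the derivatives `qn` converge uniformly in x, so the limit may be differentiated.
  have hux : ∀ t x, HasDerivAt (fun y => u t y) (q t x) x := by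
    intro t x
    refine hasDerivAt_of_tendstoUniformly (l := Filter.atTop) (f := fun n y => un n t y)
      (f' := fun n y => qn n t y) (g' := fun y => q t y) ?_
      (Filter.Eventually.of_forall fun n y => hder n t y) (fun y => hlim t y) x
    rw [Metric.tendstoUniformly_iff]
    intro ε hε
    filter_upwards [(hpow (2 * (4 * P + 4 * (Λ * k * P)) *
      Real.exp (14 * κ * max t 0))).eventually_lt_const hε] with n hn y
    rw [dist_comm, Real.dist_eq]
    exact (hqb n t y).trans_lt hn
  have c₁ : Continuous (Function.uncurry fun s y => N₁ (u s y)) := h₁.continuous.comp hu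
  have c₂ : Continuous (Function.uncurry fun s y => N₂ (u s y)) := h₂.continuous.comp hu
  have c₁' : Continuous (Function.uncurry fun s y => N₁' (u s y) * q s y) :=
    (h₁.continuous_deriv.comp hu).mul hq
  have c₂' : Continuous (Function.uncurry fun s y => N₂' (u s y) * q s y) :=
    (h₂.continuous_deriv.comp hu).mul hq
  have d₁ : ∀ t x, HasDerivAt (fun y => N₁ (u t y)) (N₁' (u t x) * q t x) x := fun t x =>
    (h₁.hasDerivAt _).comp x (hux t x)
  have d₂ : ∀ t x, HasDerivAt (fun y => N₂ (u t y)) (N₂' (u t x) * q t x) x := fun t x =>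
    (h₂.hasDerivAt _).comp x (hux t x)
  -- The contraction estimate, applied to `un n` and the limit, passes the recursion to the limit.
  have hfix : ∀ t x, u t x =
      duhamelPair κ c φ₁ φ₂ (fun s y => N₁ (u s y)) (fun s y => N₂ (u s y)) t x := by
    intro t x
    have hlim2 : Filter.Tendsto (fun n => un (n + 1) t x) Filter.atTop (nhds (u t x)) :=
      (hlim t x).comp (Filter.tendsto_add_atTop_nat 1)
    refine tendsto_nhds_unique hlim2 ?_
    rw [tendsto_iff_dist_tendsto_zero]
    refine squeeze_zero (fun _ => dist_nonneg) (fun n => ?_)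
      (hpow (1 / 4 * (2 * k) * Real.exp (7 * κ * max t 0)))
    have := abs_duhamelPair_response_sub_le (c := c) (φ₁ := φ₁) (φ₂ := φ₂) hκ h₁ h₂
      (hcont n) hu (hm n) huk (B := 2 * k * (1 / 2) ^ n) (by positivity)
      (fun t x => (hub n t x).trans (le_of_eq (by ring))) t x
    exact this.trans (le_of_eq (by ring))
  have hsumeq : ∀ t x, 0 ≤ t → duhamel κ c φ₁ (fun s y => N₁ (u s y)) t x +
      duhamel κ (-c) φ₂ (fun s y => N₂ (u s y)) t x = u t x := by
    intro t x ht
    rw [hfix t x, duhamelPair, max_eq_left ht]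
  -- The components are recovered from u alone. They are C¹ because their sources are continuous
  -- with continuous space derivative; no time derivative of u is needed.
  refine ⟨duhamel κ c φ₁ (fun s y => N₁ (u s y)), duhamel κ (-c) φ₂ (fun s y => N₂ (u s y)),
    contDiff_duhamel hφ₁ hφ₁' c₁ c₁' d₁, contDiff_duhamel hφ₂ hφ₂' c₂ c₂' d₂,
    fun x => duhamel_zero x, fun x => duhamel_zero x, fun t x ht => ?_, fun t x ht => ?_,
    fun t x ht => ⟨⟨?_, ?_⟩, ⟨?_, ?_⟩⟩⟩
  · rw [hsumeq t x ht]
    exact duhamel_transport_eq hφ₁ hφ₁' c₁ c₁' d₁ t x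
  · rw [hsumeq t x ht]
    exact duhamel_transport_eq hφ₂ hφ₂' c₂ c₂' d₂ t x
  · exact const_le_duhamel hκ c₁ (fun x => (hb₁ x).1) ht
      (fun s _ x => (h₁.mem_Icc hk (huk s x)).1) x
  · exact duhamel_le_const hκ c₁ (fun x => (hb₁ x).2) ht
      (fun s _ x => (h₁.mem_Icc hk (huk s x)).2) x
  · exact const_le_duhamel hκ c₂ (fun x => (hb₂ x).1) ht
      (fun s _ x => (h₂.mem_Icc hk (huk s x)).1) x
  · exact duhamel_le_const hκ c₂ (fun x => (hb₂ x).2) ht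
      (fun s _ x => (h₂.mem_Icc hk (huk s x)).2) x

end Picard

/-! ### Uniqueness of classical solutions -/

/-- Derivative of a `C¹` function on `[0, T] × ℝ` along a line of slope `σ`. -/
theorem hasDerivWithinAt_along_characteristic {w : ℝ → ℝ → ℝ} {T : ℝ} (hT : 0 < T)
    (hw : ContDiffOn ℝ 1 (fun p : ℝ × ℝ => w p.1 p.2) (Set.Icc 0 T ×ˢ Set.univ)) (σ b : ℝ)
    {s : ℝ} (hs : s ∈ Set.Icc 0 T) :
    HasDerivWithinAt (fun τ => w τ (b + σ * τ))
      (derivWithin (fun τ => w τ (b + σ * s)) (Set.Icc 0 T) s +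
        σ * deriv (fun y => w s y) (b + σ * s)) (Set.Icc 0 T) s := by
  set y := b + σ * s with hy
  have hmem : ((s, y) : ℝ × ℝ) ∈ Set.Icc 0 T ×ˢ (Set.univ : Set ℝ) := ⟨hs, trivial⟩
  have hF := (hw.differentiableOn one_ne_zero (s, y) hmem).hasFDerivWithinAt
  set F := fderivWithin ℝ (fun p : ℝ × ℝ => w p.1 p.2) (Set.Icc 0 T ×ˢ Set.univ) (s, y) with hFdef
  have hu : UniqueDiffWithinAt ℝ (Set.Icc 0 T) s := uniqueDiffOn_Icc hT s hs
  have e1 : derivWithin (fun τ => w τ y) (Set.Icc 0 T) s = F (1, 0) := by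
    have h := hF.comp_hasDerivWithinAt (t := Set.Icc 0 T ×ˢ Set.univ) s
      ((hasDerivWithinAt_id s (Set.Icc 0 T)).prodMk (hasDerivWithinAt_const s (Set.Icc 0 T) y))
      (fun τ hτ => ⟨hτ, trivial⟩)
    exact h.derivWithin hu
  have e2 : deriv (fun z => w s z) y = F (0, 1) := by
    have h := hF.comp_hasDerivWithinAt (t := Set.Icc 0 T ×ˢ Set.univ) y
      ((hasDerivWithinAt_const y Set.univ s).prodMk (hasDerivWithinAt_id y Set.univ))
      (fun τ _ => ⟨hs, trivial⟩)
    exact (hasDerivWithinAt_univ.1 h).deriv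
  have hl : HasDerivAt (fun τ : ℝ => b + σ * τ) σ s := by
    simpa using! ((hasDerivAt_id s).const_mul σ).const_add b
  have h := hF.comp_hasDerivWithinAt (t := Set.Icc 0 T ×ˢ Set.univ) s
      ((hasDerivWithinAt_id s (Set.Icc 0 T)).prodMk hl.hasDerivWithinAt)
      (fun τ hτ => ⟨hτ, trivial⟩)
  have e4 : F (1, σ) = F (1, 0) + σ * F (0, 1) := by
    have : ((1, σ) : ℝ × ℝ) = (1, 0) + σ • (0, 1) := by simp
    rw [this, map_add, map_smul, smul_eq_mul]
  rw [e1, e2, ← e4]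
  exact h

/-- Growth of a function that vanishes initially along a characteristic. -/
theorem abs_le_of_abs_deriv_characteristic_le {d d' : ℝ → ℝ} {T t : ℝ} (ht : t ∈ Set.Icc 0 T)
    (hd : ∀ s ∈ Set.Icc 0 T, HasDerivWithinAt d (d' s) (Set.Icc 0 T) s) (h0 : d 0 = 0)
    {A γ : ℝ} (hA : 0 ≤ A)
    (hb : ∀ s ∈ Set.Icc 0 t, |d' s| ≤ A * γ * Real.exp (γ * s)) :
    |d t| ≤ A * Real.exp (γ * t) := by
  have hsub : Set.Icc 0 t ⊆ Set.Icc 0 T := Set.Icc_subset_Icc_right ht.2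
  have h := image_norm_le_of_norm_deriv_right_le_deriv_boundary (f := d) (f' := d') (a := 0)
    (b := t) (B := fun s => A * Real.exp (γ * s)) (B' := fun s => A * γ * Real.exp (γ * s))
    (fun s hs => ((hd s (hsub hs)).mono hsub).continuousWithinAt)
    (fun s hs => ?_) (by simpa [h0] using hA) (fun s => ?_)
    (fun s hs => hb s ⟨hs.1, hs.2.le⟩) (x := t) ⟨ht.1, le_rfl⟩
  · exact h
  · have hs' : s ∈ Set.Ico 0 T := ⟨hs.1, hs.2.trans_le ht.2⟩
    exact ((hd s ⟨hs'.1, hs'.2.le⟩).mono_of_mem_nhdsWithin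
      (Icc_mem_nhdsGE_of_mem hs'))
  · have := (((hasDerivAt_id s).const_mul γ).exp).const_mul A
    convert! this using 1
    simp
    ring

/-- The backward cone of dependence with apex `(T, x₀)` and slope `c`. -/
def dependenceCone (T c x₀ : ℝ) : Set (ℝ × ℝ) :=
  {p | p.1 ∈ Set.Icc 0 T ∧ |p.2 - x₀| ≤ c * (T - p.1)}

theorem isCompact_dependenceCone {T c x₀ : ℝ} (hc : 0 ≤ c) :
    IsCompact (dependenceCone T c x₀) := by
  refine (isCompact_Icc.prod (isCompact_closedBall x₀ (c * T))).of_isClosed_subset ?_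
    (s := Set.Icc 0 T ×ˢ Metric.closedBall x₀ (c * T)) ?_
  · have h₁ : Continuous fun p : ℝ × ℝ => |p.2 - x₀| := by fun_prop
    have h₂ : Continuous fun p : ℝ × ℝ => c * (T - p.1) := by fun_prop
    exact (isClosed_Icc.preimage continuous_fst).inter (isClosed_le h₁ h₂)
  · rintro ⟨t, x⟩ ⟨ht, hx⟩
    refine ⟨ht, ?_⟩
    rw [Metric.mem_closedBall, Real.dist_eq]
    have : 0 ≤ t := ht.1
    simp only at hx
    nlinarith

/-- Going back by time t - s moves the point by at most c(t - s), which is exactly how much the cone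
widens. -/
theorem mem_dependenceCone_of_characteristic {T c x₀ σ t x s : ℝ} (hσ : |σ| ≤ c)
    (h : (t, x) ∈ dependenceCone T c x₀) (hs : s ∈ Set.Icc 0 t) :
    (s, x - σ * t + σ * s) ∈ dependenceCone T c x₀ := by
  obtain ⟨ht, hx⟩ := h
  simp only at ht hx
  refine ⟨⟨hs.1, hs.2.trans ht.2⟩, ?_⟩
  have e : x - σ * t + σ * s - x₀ = (x - x₀) - σ * (t - s) := by ring
  have : |σ * (t - s)| ≤ c * (t - s) := by
    rw [abs_mul, abs_of_nonneg (sub_nonneg.2 hs.2)]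
    exact mul_le_mul_of_nonneg_right hσ (sub_nonneg.2 hs.2)
  simp only [e]
  exact (abs_sub _ _).trans (by linarith)

/-- Uniqueness for the semilinear two-speed system: `C¹` solutions with the same data agree. -/
theorem relaxation_solution_unique {T c κ : ℝ} (hT : 0 < T) (hc : 0 ≤ c)
    {N₁ N₂ : ℝ → ℝ}
    (hN : ∀ r : ℝ, ∃ L ≥ (0 : ℝ), ∀ v ∈ Set.Icc (-r) r, ∀ w ∈ Set.Icc (-r) r,
      |N₁ v - N₁ w| ≤ L * |v - w| ∧ |N₂ v - N₂ w| ≤ L * |v - w|)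
    {f₁ f₂ g₁ g₂ : ℝ → ℝ → ℝ}
    (hf₁ : ContDiffOn ℝ 1 (fun p : ℝ × ℝ => f₁ p.1 p.2) (Set.Icc 0 T ×ˢ Set.univ))
    (hf₂ : ContDiffOn ℝ 1 (fun p : ℝ × ℝ => f₂ p.1 p.2) (Set.Icc 0 T ×ˢ Set.univ))
    (hg₁ : ContDiffOn ℝ 1 (fun p : ℝ × ℝ => g₁ p.1 p.2) (Set.Icc 0 T ×ˢ Set.univ))
    (hg₂ : ContDiffOn ℝ 1 (fun p : ℝ × ℝ => g₂ p.1 p.2) (Set.Icc 0 T ×ˢ Set.univ))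
    (ef₁ : ∀ t ∈ Set.Icc 0 T, ∀ x, derivWithin (fun τ => f₁ τ x) (Set.Icc 0 T) t +
      c * deriv (fun y => f₁ t y) x = κ * (N₁ (f₁ t x + f₂ t x) - f₁ t x))
    (ef₂ : ∀ t ∈ Set.Icc 0 T, ∀ x, derivWithin (fun τ => f₂ τ x) (Set.Icc 0 T) t +
      -c * deriv (fun y => f₂ t y) x = κ * (N₂ (f₁ t x + f₂ t x) - f₂ t x))
    (eg₁ : ∀ t ∈ Set.Icc 0 T, ∀ x, derivWithin (fun τ => g₁ τ x) (Set.Icc 0 T) t +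
      c * deriv (fun y => g₁ t y) x = κ * (N₁ (g₁ t x + g₂ t x) - g₁ t x))
    (eg₂ : ∀ t ∈ Set.Icc 0 T, ∀ x, derivWithin (fun τ => g₂ τ x) (Set.Icc 0 T) t +
      -c * deriv (fun y => g₂ t y) x = κ * (N₂ (g₁ t x + g₂ t x) - g₂ t x))
    (h₁ : ∀ x, f₁ 0 x = g₁ 0 x) (h₂ : ∀ x, f₂ 0 x = g₂ 0 x) :
    ∀ t ∈ Set.Icc 0 T, ∀ x, f₁ t x = g₁ t x ∧ f₂ t x = g₂ t x := by
  intro t₀ ht₀ x₀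
  -- Classical solutions may be unbounded in x. On this compact cone they are bounded, and the
  -- Maxwellians need only be Lipschitz on bounded sets.
  set D := dependenceCone t₀ c x₀ with hD
  have hDc : IsCompact D := isCompact_dependenceCone hc
  have hDsub : D ⊆ Set.Icc 0 T ×ˢ Set.univ := fun p hp => ⟨⟨hp.1.1, hp.1.2.trans ht₀.2⟩, trivial⟩
  obtain ⟨b₁, hb₁⟩ := hDc.exists_bound_of_continuousOn (hf₁.continuousOn.mono hDsub)
  obtain ⟨b₂, hb₂⟩ := hDc.exists_bound_of_continuousOn (hf₂.continuousOn.mono hDsub)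
  obtain ⟨b₃, hb₃⟩ := hDc.exists_bound_of_continuousOn (hg₁.continuousOn.mono hDsub)
  obtain ⟨b₄, hb₄⟩ := hDc.exists_bound_of_continuousOn (hg₂.continuousOn.mono hDsub)
  simp only [Real.norm_eq_abs] at hb₁ hb₂ hb₃ hb₄
  set B := |b₁| + |b₂| + |b₃| + |b₄| with hB
  have hB0 : 0 ≤ B := by positivity
  have le₁ := le_abs_self b₁
  have le₂ := le_abs_self b₂
  have le₃ := le_abs_self b₃
  have le₄ := le_abs_self b₄
  have p₁ := abs_nonneg b₁
  have p₂ := abs_nonneg b₂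
  have p₃ := abs_nonneg b₃
  have p₄ := abs_nonneg b₄
  obtain ⟨L₀, hL₀, hLip⟩ := hN B
  set L := |κ| * (L₀ + 1) with hL
  have hL' : 0 ≤ L := by positivity
  have huf : ∀ p ∈ D, f₁ p.1 p.2 + f₂ p.1 p.2 ∈ Set.Icc (-B) B := fun p hp => by
    have i₁ := abs_le.1 (hb₁ p hp); have i₂ := abs_le.1 (hb₂ p hp)
    constructor <;> linarith [i₁.1, i₁.2, i₂.1, i₂.2]
  have hug : ∀ p ∈ D, g₁ p.1 p.2 + g₂ p.1 p.2 ∈ Set.Icc (-B) B := fun p hp => by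
    have i₁ := abs_le.1 (hb₃ p hp); have i₂ := abs_le.1 (hb₄ p hp)
    constructor <;> linarith [i₁.1, i₁.2, i₂.1, i₂.2]
  have hsource : ∀ {N : ℝ → ℝ} {u v a b m : ℝ}, |N u - N v| ≤ L₀ * |u - v| → |u - v| ≤ 2 * m →
      |a - b| ≤ m → |κ * (N u - a) - κ * (N v - b)| ≤ 2 * L * m := by
    intro N u v a b m i j l
    have hm : 0 ≤ m := (abs_nonneg _).trans l
    have e : κ * (N u - a) - κ * (N v - b) = κ * ((N u - N v) - (a - b)) := by ring
    rw [e, abs_mul, hL]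
    calc |κ| * |N u - N v - (a - b)| ≤ |κ| * (L₀ * (2 * m) + m) := by
          gcongr
          exact (abs_sub _ _).trans (add_le_add (i.trans (by gcongr)) l)
      _ ≤ _ := by nlinarith [abs_nonneg κ, mul_nonneg (abs_nonneg κ) hm]
  -- Each integration along characteristics halves the bound: if both differences are at most m = B
  -- 2⁻ⁿ exp(4Lt), the sources differ by at most 2Lm, the derivative of m/2. As n grows, the
  -- differences vanish.
  have key : ∀ n : ℕ, ∀ p ∈ D, |f₁ p.1 p.2 - g₁ p.1 p.2| ≤ B * (1 / 2) ^ n * Real.exp (4 * L * p.1)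
      ∧ |f₂ p.1 p.2 - g₂ p.1 p.2| ≤ B * (1 / 2) ^ n * Real.exp (4 * L * p.1) := by
    intro n
    induction n with
    | zero =>
      intro p hp
      have he : 1 ≤ Real.exp (4 * L * p.1) :=
        Real.one_le_exp (mul_nonneg (by positivity) hp.1.1)
      rw [pow_zero, mul_one]
      constructor
      · refine (abs_sub _ _).trans (le_trans ?_ (le_mul_of_one_le_right hB0 he))
        linarith [hb₁ p hp, hb₃ p hp]
      · refine (abs_sub _ _).trans (le_trans ?_ (le_mul_of_one_le_right hB0 he))
        linarith [hb₂ p hp, hb₄ p hp]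
    | succ n ih =>
      rintro ⟨t, x⟩ hp
      have ht : t ∈ Set.Icc 0 T := (hDsub hp).1
      have step : ∀ (σ : ℝ) (w z : ℝ → ℝ → ℝ) (N : ℝ → ℝ), |σ| ≤ c →
          ContDiffOn ℝ 1 (fun p : ℝ × ℝ => w p.1 p.2) (Set.Icc 0 T ×ˢ Set.univ) →
          ContDiffOn ℝ 1 (fun p : ℝ × ℝ => z p.1 p.2) (Set.Icc 0 T ×ˢ Set.univ) →
          (∀ t ∈ Set.Icc 0 T, ∀ x, derivWithin (fun τ => w τ x) (Set.Icc 0 T) t +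
            σ * deriv (fun y => w t y) x = κ * (N (f₁ t x + f₂ t x) - w t x)) →
          (∀ t ∈ Set.Icc 0 T, ∀ x, derivWithin (fun τ => z τ x) (Set.Icc 0 T) t +
            σ * deriv (fun y => z t y) x = κ * (N (g₁ t x + g₂ t x) - z t x)) →
          (∀ x, w 0 x = z 0 x) →
          (∀ v ∈ Set.Icc (-B) B, ∀ w ∈ Set.Icc (-B) B, |N v - N w| ≤ L₀ * |v - w|) →
          (∀ p ∈ D, |w p.1 p.2 - z p.1 p.2| ≤ B * (1 / 2) ^ n * Real.exp (4 * L * p.1)) →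
          |w t x - z t x| ≤ B * (1 / 2) ^ (n + 1) * Real.exp (4 * L * t) := by
        intro σ w z N hσ hw hz ew ez h0 hNL hwz
        have hder : ∀ s ∈ Set.Icc 0 T, HasDerivWithinAt
            (fun τ => w τ (x - σ * t + σ * τ) - z τ (x - σ * t + σ * τ)) _ (Set.Icc 0 T) s :=
          fun s hs => (hasDerivWithinAt_along_characteristic hT hw σ (x - σ * t) hs).sub
            (hasDerivWithinAt_along_characteristic hT hz σ (x - σ * t) hs)
        have := abs_le_of_abs_deriv_characteristic_le ht hder (by simp [h0])
          (A := B * (1 / 2) ^ (n + 1)) (γ := 4 * L) (by positivity) ?_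
        · simpa using this
        intro s hs
        have hmem := mem_dependenceCone_of_characteristic hσ hp hs
        have hsT : s ∈ Set.Icc 0 T := (hDsub hmem).1
        rw [ew s hsT, ez s hsT]
        have ih' := ih _ hmem
        refine (hsource (m := B * (1 / 2) ^ n * Real.exp (4 * L * s))
          (hNL _ (huf _ hmem) _ (hug _ hmem)) ?_ (hwz _ hmem)).trans (le_of_eq ?_)
        · rw [add_sub_add_comm, two_mul]
          exact (abs_add_le _ _).trans (add_le_add ih'.1 ih'.2)
        · rw [pow_succ]; ring
      exact ⟨step c f₁ g₁ N₁ (abs_of_nonneg hc).le hf₁ hg₁ ef₁ eg₁ h₁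
          (fun v hv w hw => (hLip v hv w hw).1) (fun p hp => (ih p hp).1),
        step (-c) f₂ g₂ N₂ (by rw [abs_neg, abs_of_nonneg hc]) hf₂ hg₂ ef₂ eg₂ h₂
          (fun v hv w hw => (hLip v hv w hw).2) (fun p hp => (ih p hp).2)⟩
  have hmem : (t₀, x₀) ∈ D := ⟨⟨ht₀.1, le_rfl⟩, by simp⟩
  have hlim : Filter.Tendsto (fun n : ℕ => B * (1 / 2) ^ n * Real.exp (4 * L * t₀)) Filter.atTop
      (nhds 0) := by
    simpa using! ((tendsto_pow_atTop_nhds_zero_of_lt_one (r := (1 / 2 : ℝ)) (by norm_num)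
        (by norm_num)).const_mul B).mul_const (Real.exp (4 * L * t₀))
  have hz : ∀ a : ℝ, (∀ n : ℕ, |a| ≤ B * (1 / 2) ^ n * Real.exp (4 * L * t₀)) → a = 0 :=
    fun a ha => abs_eq_zero.1 (le_antisymm (ge_of_tendsto' hlim ha) (abs_nonneg a))
  exact ⟨sub_eq_zero.1 (hz _ fun n => (key n _ hmem).1),
    sub_eq_zero.1 (hz _ fun n => (key n _ hmem).2)⟩

/-! ### Construction of the kinetic entropy -/

/-- The supporting line inequality for a differentiable convex function on `ℝ`. -/
theorem ConvexOn.deriv_mul_sub_le {H : ℝ → ℝ} (hc : ConvexOn ℝ Set.univ H)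
    (hd : Differentiable ℝ H) (x y : ℝ) : deriv H x * (y - x) ≤ H y - H x := by
  rcases lt_trichotomy x y with h | rfl | h
  · have := hc.deriv_le_slope (Set.mem_univ x) (Set.mem_univ y) h (hd x)
    rw [slope_def_field, le_div_iff₀ (sub_pos.2 h)] at this
    exact this
  · simp
  · have := hc.slope_le_deriv (Set.mem_univ y) (Set.mem_univ x) h (hd x)
    rw [slope_def_field, div_le_iff₀ (sub_pos.2 h)] at this
    linarith

/-- The component of the kinetic entropy that belongs to a Maxwellian `M`: a convex function `H`
whose derivative is `α v + β` at `M v`. -/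
theorem exists_entropy_component {M M' : ℝ → ℝ} (hM : ∀ v, HasDerivAt M (M' v) v)
    (hM' : Continuous M') (hl : ∀ v, 1 / 4 ≤ M' v) (hu : ∀ v, M' v ≤ 3 / 4) {α : ℝ} (hα : 0 < α)
    (β H₀ : ℝ) :
    ∃ H : ℝ → ℝ, ContDiff ℝ 2 H ∧ ConvexOn ℝ Set.univ H ∧ H (M 0) = H₀ ∧
      (∀ v, deriv H (M v) = α * v + β) ∧ (∀ v, deriv (deriv H) (M v) = α / M' v) ∧
      ∀ g g', α * (g - g') ^ 2 ≤ (deriv H g - deriv H g') * (g - g') := by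
  have hMc : Continuous M := continuous_iff_continuousAt.2 fun v => (hM v).continuousAt
  have hMmono : StrictMono M := strictMono_of_hasDerivAt_pos hM fun v => by linarith [hl v]
  have hgrow : ∀ v w, v ≤ w → 1 / 4 * (w - v) ≤ M w - M v := by
    intro v w hvw
    have hmono : Monotone fun v => M v - 1 / 4 * v :=
      monotone_of_hasDerivAt_nonneg (f' := fun v => M' v - 1 / 4)
        (fun v => ((hM v).sub ((hasDerivAt_id v).const_mul (1 / 4))).congr_deriv (by simp))
        (fun v => sub_nonneg.2 (hl v))
    have := hmono hvw
    simp only at this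
    linarith
  -- Slope at least 1/4 everywhere forces M onto ℝ, so its inverse is global and C¹.
  have hsurj : Function.Surjective M := by
    refine hMc.surjective ?_ ?_
    · refine Filter.tendsto_atTop_mono' _ (f₁ := fun v => M 0 + 1 / 4 * v) ?_ ?_
      · filter_upwards [Filter.eventually_ge_atTop 0] with v hv
        linarith [hgrow 0 v hv]
      · exact Filter.tendsto_atTop_add_const_left _ _
          (Filter.tendsto_id.const_mul_atTop (by norm_num))
    · refine Filter.tendsto_atBot_mono' _ (f₂ := M) (f₁ := fun v => M 0 + 1 / 4 * v) ?_ ?_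
      · filter_upwards [Filter.eventually_le_atBot 0] with v hv
        linarith [hgrow v 0 hv]
      · exact Filter.tendsto_atBot_add_const_left _ _
          (Filter.tendsto_id.const_mul_atBot (by norm_num))
  set e := hMmono.orderIsoOfSurjective M hsurj with he
  set ψ : ℝ → ℝ := fun g => e.symm g with hψ
  have hψM : ∀ v, ψ (M v) = v := fun v => e.symm_apply_apply v
  have hMψ : ∀ g, M (ψ g) = g := fun g => e.apply_symm_apply g
  have hψc : Continuous ψ := e.symm.continuous
  have hψd : ∀ g, HasDerivAt ψ (M' (ψ g))⁻¹ g := fun g =>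
    HasDerivAt.of_local_left_inverse hψc.continuousAt (hM (ψ g)) (by linarith [hl (ψ g)])
      (Filter.Eventually.of_forall hMψ)
  set D : ℝ → ℝ := fun g => α * ψ g + β with hD
  have hDc : Continuous D := by fun_prop
  have hDd : ∀ g, HasDerivAt D (α / M' (ψ g)) g := fun g => by
    rw [div_eq_mul_inv]; exact ((hψd g).const_mul α).add_const β
  set H : ℝ → ℝ := fun g => H₀ + ∫ s in (M 0)..g, D s with hH
  have hHd : ∀ g, HasDerivAt H (D g) g := fun g =>
    (hDc.integral_hasStrictDerivAt (M 0) g).hasDerivAt.const_add H₀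
  have hHD : deriv H = D := funext fun g => (hHd g).deriv
  have hDD : deriv D = fun g => α / M' (ψ g) := funext fun g => (hDd g).deriv
  have hpos : ∀ v, 0 < M' v := fun v => by linarith [hl v]
  -- D' = α/M' ≥ α because M' ≤ 3/4 < 1.
  have hstrong : ∀ g g', g' ≤ g → α * (g - g') ≤ D g - D g' := by
    intro g g' hg
    have hmono : Monotone fun g => D g - α * g :=
      monotone_of_hasDerivAt_nonneg (f' := fun g => α / M' (ψ g) - α)
        (fun g => by simpa using! (hDd g).sub ((hasDerivAt_id g).const_mul α))
        (fun g => sub_nonneg.2 (by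
          rw [le_div_iff₀ (hpos _)]
          nlinarith [hu (ψ g)]))
    have := hmono hg
    simp only at this
    linarith
  refine ⟨H, ?_, ?_, by simp [hH], fun v => by simp [hHD, hD, hψM], fun v => by
    simp [hHD, hDD, hψM], fun g g' => ?_⟩
  · have : ContDiff ℝ (1 + 1) H := by
      rw [contDiff_succ_iff_deriv]
      refine ⟨fun g => (hHd g).differentiableAt, by simp, ?_⟩
      rw [hHD, contDiff_one_iff_deriv]
      refine ⟨fun g => (hDd g).differentiableAt, ?_⟩
      rw [hDD]
      exact continuous_const.div (hM'.comp hψc) fun g => (hpos _).ne'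
    simpa [one_add_one_eq_two] using! this
  · refine convexOn_univ_of_deriv2_nonneg (fun g => (hHd g).differentiableAt) ?_ ?_
    · rw [hHD]; exact fun g => (hDd g).differentiableAt
    · intro g
      simp only [Function.iterate_succ, Function.iterate_zero, Function.comp, id, hHD, hDD]
      exact (div_pos hα (hpos _)).le
  · rw [hHD]
    rcases le_total g' g with h | h
    · nlinarith [hstrong g g' h]
    · nlinarith [hstrong g' g h]

section Kinetic

variable {lam eps : ℝ} {f f' : ℝ → ℝ}

theorem maxwellian_add (lam eps : ℝ) (f : ℝ → ℝ) (v : ℝ) :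
    maxwellian₁ lam eps f v + maxwellian₂ lam eps f v = v := by
  unfold maxwellian₁ maxwellian₂; ring

theorem hasDerivAt_maxwellian₁ {v d : ℝ} (hf : HasDerivAt f d v) :
    HasDerivAt (maxwellian₁ lam eps f) (1 / 2 + eps * d / (2 * lam)) v :=
  ((hasDerivAt_id v).div_const 2).add ((hf.const_mul eps).div_const (2 * lam))

theorem hasDerivAt_maxwellian₂ {v d : ℝ} (hf : HasDerivAt f d v) :
    HasDerivAt (maxwellian₂ lam eps f) (1 / 2 - eps * d / (2 * lam)) v :=
  ((hasDerivAt_id v).div_const 2).sub ((hf.const_mul eps).div_const (2 * lam))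

/-- The subcharacteristic condition in the form used throughout: it places the derivatives 1/2 ±
εd/(2λ) of the Maxwellians in [1/4, 3/4]. -/
theorem abs_slope_le {G d : ℝ} (hlam : 0 < lam) (heps : 0 < eps) (hG : |d| ≤ G)
    (hsub : eps * G ≤ lam / 2) : |eps * d / (2 * lam)| ≤ 1 / 4 := by
  rw [abs_div, abs_mul, abs_of_pos heps, abs_of_pos (by positivity : 0 < 2 * lam),
    div_le_iff₀ (by positivity)]
  nlinarith

/-- Meant for m = Mᵢ'(v) and 2α = η'': then 2α/m is the second derivative of Hᵢ at equilibrium. -/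
theorem abs_div_sub_le {α m G : ℝ} (hα : 0 ≤ α) (hm : 1 / 4 ≤ m)
    (h : |m - 1 / 2| ≤ eps * G / (2 * lam)) :
    |2 * α / m - 2 * (2 * α)| ≤ 8 * α * G / lam * eps := by
  have hpos : 0 < m := by linarith
  have e : 2 * α / m - 2 * (2 * α) = -(4 * α) * (m - 1 / 2) / m := by
    field_simp
    ring
  rw [e, abs_div, abs_mul, abs_neg, abs_of_pos hpos, abs_of_nonneg (by positivity : 0 ≤ 4 * α)]
  have h0 := (abs_nonneg _).trans h
  calc 4 * α * |m - 1 / 2| / m ≤ 4 * α * (eps * G / (2 * lam)) / (1 / 4) := by gcongr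
    _ = _ := by ring

/-- Under the subcharacteristic condition every quadratic entropy extends to a kinetic entropy. -/
theorem exists_kineticEntropy (hlam : 0 < lam) (heps : 0 < eps) (hf : ∀ v, HasDerivAt f (f' v) v)
    (hf' : Continuous f') {G : ℝ} (hG : ∀ v, |f' v| ≤ G) (hsub : eps * G ≤ lam / 2)
    {η : ℝ → ℝ} {α β γ : ℝ} (hα : 0 < α) (hη : ∀ u, η u = α * u ^ 2 + β * u + γ) (R : ℝ) :
    ∃ H₁ H₂ : ℝ → ℝ, IsKineticEntropy lam eps f η R (2 * α) H₁ H₂ ∧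
      ∀ v, deriv H₁ (maxwellian₁ lam eps f v) = deriv η v ∧
        deriv H₂ (maxwellian₂ lam eps f v) = deriv η v ∧
        |deriv (deriv H₁) (maxwellian₁ lam eps f v) - 2 * deriv (deriv η) v| ≤
          8 * α * G / lam * eps ∧
        |deriv (deriv H₂) (maxwellian₂ lam eps f v) - 2 * deriv (deriv η) v| ≤
          8 * α * G / lam * eps := by
  set M₁ := maxwellian₁ lam eps f with hM₁
  set M₂ := maxwellian₂ lam eps f with hM₂
  have hsum : ∀ v, M₁ v + M₂ v = v := maxwellian_add lam eps f
  have d₁ := fun v => hasDerivAt_maxwellian₁ (lam := lam) (eps := eps) (hf v)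
  have d₂ := fun v => hasDerivAt_maxwellian₂ (lam := lam) (eps := eps) (hf v)
  have hs := fun v => abs_le.1 (abs_slope_le hlam heps (hG v) hsub)
  have hslope : ∀ v, |eps * f' v / (2 * lam)| ≤ eps * G / (2 * lam) := by
    intro v
    rw [abs_div, abs_mul, abs_of_pos heps, abs_of_pos (by positivity : 0 < 2 * lam)]
    gcongr
    exact hG v
  have hηd : ∀ v, HasDerivAt η (2 * α * v + β) v := by
    intro v
    have : η = fun u => α * u ^ 2 + β * u + γ := funext hη
    rw [this]
    refine ((((hasDerivAt_pow 2 v).const_mul α).add ((hasDerivAt_id v).const_mul β)).add_const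
      γ).congr_deriv ?_
    simp; ring
  have hη' : deriv η = fun v => 2 * α * v + β := funext fun v => (hηd v).deriv
  have hη'' : ∀ v, deriv (deriv η) v = 2 * α := by
    intro v
    rw [hη']
    have : HasDerivAt (fun v => 2 * α * v + β) (2 * α) v := by
      simpa using! ((hasDerivAt_id v).const_mul (2 * α)).add_const β
    exact this.deriv
  -- The slope parameter is 2α because η'(v) = 2αv + β. The values γ and 0 at M₁(0) and M₂(0) fix
  -- the integration constants so that they add up to η(0).
  obtain ⟨H₁, hc₁, hv₁, h0₁, hd₁, hdd₁, hm₁⟩ := exists_entropy_component d₁ (by fun_prop)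
    (fun v => by linarith [(hs v).1]) (fun v => by linarith [(hs v).2])
    (α := 2 * α) (by positivity) β γ
  obtain ⟨H₂, hc₂, hv₂, h0₂, hd₂, hdd₂, hm₂⟩ := exists_entropy_component d₂ (by fun_prop)
    (fun v => by linarith [(hs v).2]) (fun v => by linarith [(hs v).1])
    (α := 2 * α) (by positivity) β 0
  have D₁ : Differentiable ℝ H₁ := hc₁.differentiable two_ne_zero
  have D₂ : Differentiable ℝ H₂ := hc₂.differentiable two_ne_zero
  have hequil : ∀ v, H₁ (M₁ v) + H₂ (M₂ v) = η v := by
    have hder : ∀ v, HasDerivAt (fun v => H₁ (M₁ v) + H₂ (M₂ v) - η v) 0 v := by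
      intro v
      have e₁ := (D₁ (M₁ v)).hasDerivAt.comp v (d₁ v)
      have e₂ := (D₂ (M₂ v)).hasDerivAt.comp v (d₂ v)
      refine ((e₁.add e₂).sub (hηd v)).congr_deriv ?_
      rw [hd₁, hd₂]; ring
    intro v
    have := is_const_of_deriv_eq_zero (fun v => (hder v).differentiableAt)
      (fun v => (hder v).deriv) v 0
    rw [h0₁, h0₂, hη 0] at this
    linarith
  refine ⟨H₁, H₂, ⟨hc₁, hc₂, hv₁, hv₂, fun v _ => ⟨?_, ?_⟩, fun v _ => hequil v, fun v _ g₁ g₂ h => ?_,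
    fun g₁ g₂ _ => ?_⟩, fun v => ⟨?_, ?_, ?_, ?_⟩⟩
  · exact ⟨M₁ v, M₂ v, hsum v, (hequil v).symm⟩
  · rintro y ⟨g₁, g₂, h, rfl⟩
    have i₁ := hv₁.deriv_mul_sub_le D₁ (M₁ v) g₁
    have i₂ := hv₂.deriv_mul_sub_le D₂ (M₂ v) g₂
    rw [hd₁] at i₁
    rw [hd₂] at i₂
    -- The supporting lines at M₁(v) and M₂(v) have the same slope η'(v), so their increments cancel
    -- when g₁ + g₂ = v.
    have e : (2 * α * v + β) * (g₁ - M₁ v) + (2 * α * v + β) * (g₂ - M₂ v) = 0 := by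
      rw [← mul_add]
      have : g₁ - M₁ v + (g₂ - M₂ v) = 0 := by linarith [hsum v]
      rw [this, mul_zero]
    linarith [hequil v]
  · rw [hd₁, hd₂, ← mul_add, h, mul_zero]
  · set v := g₁ + g₂ with hvdef
    have i₁ := hm₁ g₁ (M₁ v)
    have i₂ := hm₂ g₂ (M₂ v)
    rw [hd₁] at i₁
    rw [hd₂] at i₂
    -- The deviations from equilibrium are opposite, so the equal equilibrium slopes drop out when
    -- the two strong monotonicity bounds are added.
    have e : g₂ - M₂ v = -(g₁ - M₁ v) := by linarith [hsum v]
    have e' : M₂ v - g₂ = g₁ - M₁ v := by linarith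
    rw [e', e]
    rw [e] at i₂
    nlinarith
  · rw [hd₁, hη']
  · rw [hd₂, hη']
  · rw [hdd₁, hη'']
    refine abs_div_sub_le hα.le (by linarith [(hs v).1]) ?_
    rw [add_sub_cancel_left]
    exact hslope v
  · rw [hdd₂, hη'']
    refine abs_div_sub_le hα.le (by linarith [(hs v).2]) ?_
    rw [sub_sub_cancel_left, abs_neg]
    exact hslope v

/-- The kinetic entropy property only depends on the flux at the states `|v| ≤ R`. -/
theorem IsKineticEntropy.congr_flux {g η H₁ H₂ : ℝ → ℝ} {R c : ℝ}
    (h : IsKineticEntropy lam eps g η R c H₁ H₂) (hfg : ∀ v, |v| ≤ R → g v = f v) :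
    IsKineticEntropy lam eps f η R c H₁ H₂ := by
  have e₁ : ∀ v, |v| ≤ R → maxwellian₁ lam eps f v = maxwellian₁ lam eps g v := fun v hv => by
    simp only [maxwellian₁, hfg v hv]
  have e₂ : ∀ v, |v| ≤ R → maxwellian₂ lam eps f v = maxwellian₂ lam eps g v := fun v hv => by
    simp only [maxwellian₂, hfg v hv]
  refine ⟨h.contDiff₁, h.contDiff₂, h.convex₁, h.convex₂, h.isLeast, fun v hv => ?_,
    fun v hv => ?_, fun g₁ g₂ hg => ?_⟩
  · rw [e₁ v hv, e₂ v hv]; exact h.equilibrium v hv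
  · rw [e₁ v hv, e₂ v hv]; exact h.orthogonal v hv
  · rw [e₁ _ hg, e₂ _ hg]; exact h.dissipative g₁ g₂ hg

/-- A kinetic entropy satisfies the entropy inequalities along every classical solution whose
density stays in the range of the entropy. -/
theorem IsKineticEntropy.satisfiesEntropyInequality {η H₁ H₂ : ℝ → ℝ} {R c T : ℝ}
    (h : IsKineticEntropy lam eps f η R c H₁ H₂) (hT : 0 < T) {f₁ f₂ : ℝ → ℝ → ℝ}
    (hs : IsBGKSolution lam eps f T f₁ f₂)
    (hR : ∀ t ∈ Set.Icc 0 T, ∀ x, |f₁ t x + f₂ t x| ≤ R) :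
    SatisfiesEntropyInequality lam eps f T c H₁ H₂ f₁ f₂ := by
  have D₁ : Differentiable ℝ H₁ := h.contDiff₁.differentiable two_ne_zero
  have D₂ : Differentiable ℝ H₂ := h.contDiff₂.differentiable two_ne_zero
  have hdiff : ∀ {w : ℝ → ℝ → ℝ},
      ContDiffOn ℝ 1 (fun p : ℝ × ℝ => w p.1 p.2) (Set.Icc 0 T ×ˢ Set.univ) →
      ∀ t ∈ Set.Icc 0 T, ∀ x, DifferentiableWithinAt ℝ (fun τ => w τ x) (Set.Icc 0 T) t ∧
        DifferentiableAt ℝ (fun y => w t y) x := by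
    intro w hw t ht x
    have hd := hw.differentiableOn one_ne_zero (t, x) ⟨ht, trivial⟩
    refine ⟨hd.comp t (f := fun τ => (τ, x)) (by fun_prop) fun τ hτ => ⟨hτ, trivial⟩, ?_⟩
    rw [← differentiableWithinAt_univ]
    exact hd.comp x (f := fun y => (t, y)) (by fun_prop) fun y _ => ⟨ht, trivial⟩
  have hbal : ∀ t ∈ Set.Icc 0 T, ∀ x, entropyProduction lam eps T H₁ H₂ f₁ f₂ t x =
      1 / eps ^ 2 *
        (deriv H₁ (f₁ t x) * (maxwellian₁ lam eps f (f₁ t x + f₂ t x) - f₁ t x) +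
          deriv H₂ (f₂ t x) * (maxwellian₂ lam eps f (f₁ t x + f₂ t x) - f₂ t x)) := by
    intro t ht x
    obtain ⟨t₁, x₁⟩ := hdiff hs.contDiffOn₁ t ht x
    obtain ⟨t₂, x₂⟩ := hdiff hs.contDiffOn₂ t ht x
    have hu : UniqueDiffWithinAt ℝ (Set.Icc 0 T) t := uniqueDiffOn_Icc hT t ht
    have e₁ : derivWithin (fun τ => H₁ (f₁ τ x) + H₂ (f₂ τ x)) (Set.Icc 0 T) t =
        deriv H₁ (f₁ t x) * derivWithin (fun τ => f₁ τ x) (Set.Icc 0 T) t +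
          deriv H₂ (f₂ t x) * derivWithin (fun τ => f₂ τ x) (Set.Icc 0 T) t :=
      (((D₁ _).hasDerivAt.comp_hasDerivWithinAt t t₁.hasDerivWithinAt).add
        ((D₂ _).hasDerivAt.comp_hasDerivWithinAt t t₂.hasDerivWithinAt)).derivWithin hu
    have e₂ : deriv (fun y => H₁ (f₁ t y) - H₂ (f₂ t y)) x =
        deriv H₁ (f₁ t x) * deriv (fun y => f₁ t y) x -
          deriv H₂ (f₂ t x) * deriv (fun y => f₂ t y) x :=
      (((D₁ _).hasDerivAt.comp x x₁.hasDerivAt).sub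
        ((D₂ _).hasDerivAt.comp x x₂.hasDerivAt)).deriv
    unfold entropyProduction
    rw [e₁, e₂]
    -- Each equation is multiplied by the derivative of its entropy component, as in the chain rule.
    linear_combination deriv H₁ (f₁ t x) * hs.eqn₁ t ht x + deriv H₂ (f₂ t x) * hs.eqn₂ t ht x
  have hpos : 0 ≤ 1 / eps ^ 2 := by positivity
  refine ⟨hbal, fun t ht x => ?_, fun t ht x => ?_, fun t ht x => ?_⟩
  · rw [hbal t ht x]
    refine mul_le_mul_of_nonneg_left ?_ hpos
    linarith [h.convex₁.deriv_mul_sub_le D₁ (f₁ t x) (maxwellian₁ lam eps f (f₁ t x + f₂ t x)),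
      h.convex₂.deriv_mul_sub_le D₂ (f₂ t x) (maxwellian₂ lam eps f (f₁ t x + f₂ t x))]
  · rw [h.equilibrium _ (hR t ht x)]
    exact (h.isLeast _ (hR t ht x)).2 ⟨f₁ t x, f₂ t x, rfl, rfl⟩
  · rw [hbal t ht x]
    refine (mul_le_mul_of_nonneg_left (h.dissipative _ _ (hR t ht x)) hpos).trans
      (le_of_eq (by ring))

end Kinetic

/-! ### Flux cutoff, well-prepared data and the main theorem -/

theorem exists_lipschitz_on_Icc {F F' : ℝ → ℝ} (hF : ∀ v, HasDerivAt F (F' v) v)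
    (hF' : Continuous F') (r : ℝ) :
    ∃ L ≥ (0 : ℝ), ∀ v ∈ Set.Icc (-r) r, ∀ w ∈ Set.Icc (-r) r, |F v - F w| ≤ L * |v - w| := by
  obtain ⟨L, hL⟩ := isCompact_Icc.exists_bound_of_continuousOn (s := Set.Icc (-r) r)
    hF'.continuousOn
  refine ⟨|L|, abs_nonneg L, fun v hv w hw => ?_⟩
  simpa using! (convex_Icc (-r) r).norm_image_sub_le_of_norm_hasDerivWithin_le (f := F) (f' := F')
    (C := |L|) (fun v _ => (hF v).hasDerivWithinAt) (fun v hv => (hL v hv).trans (le_abs_self L))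
    hw hv

theorem FluxAssumptions.exists_derivs {a : ℝ} {f : ℝ → ℝ} (hf : FluxAssumptions a f) :
    ContDiff ℝ 2 f ∧ ∃ f' f'' : ℝ → ℝ, (∀ v, HasDerivAt f (f' v) v) ∧
      (∀ v, HasDerivAt f' (f'' v) v) ∧ Continuous f' ∧ Continuous f'' := by
  obtain ⟨h, -, hh⟩ := hf.eq_poly
  have hfp : f = fun u => (Polynomial.C a * Polynomial.X + h).eval u := by
    funext u
    simp [hh u]
  set p := Polynomial.C a * Polynomial.X + h
  subst hfp
  exact ⟨by simpa using! p.contDiff_aeval (𝕜 := ℝ) 2, fun u => p.derivative.eval u, fun u => p.derivative.derivative.eval u,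
    fun v => p.hasDerivAt v, fun v => p.derivative.hasDerivAt v, p.derivative.continuous,
    p.derivative.derivative.continuous⟩

/-- A `C²` function agrees on `[-R, R]` with a `C¹` function with bounded derivative. -/
theorem exists_cutoff {f : ℝ → ℝ} (hf : ContDiff ℝ 2 f) {R : ℝ} (hR : 0 < R) :
    ∃ (g g' : ℝ → ℝ) (G : ℝ), (∀ v, HasDerivAt g (g' v) v) ∧ Continuous g' ∧ (∀ v, |g' v| ≤ G) ∧
      (∀ v, |v| ≤ R → g v = f v) ∧ ∀ v, |v| ≤ R → HasDerivAt f (g' v) v := by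
  -- The bump is 1 up to R + 1, beyond R, so that derivatives agree at v = ±R as well.
  let χ : ContDiffBump (0 : ℝ) := ⟨R + 1, R + 2, by linarith, by linarith⟩
  set g : ℝ → ℝ := fun v => χ v * f v with hg
  have hgc : ContDiff ℝ 2 g := χ.contDiff.mul hf
  have hgs : HasCompactSupport g := χ.hasCompactSupport.mul_right
  have hg'c : Continuous (deriv g) := hgc.continuous_deriv one_le_two
  obtain ⟨G, hG⟩ := hg'c.bounded_above_of_compact_support hgs.deriv
  have hgd : ∀ v, HasDerivAt g (deriv g v) v := fun v =>
    (hgc.differentiable two_ne_zero v).hasDerivAt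
  have hone : ∀ v, |v| ≤ R + 1 → g v = f v := fun v hv => by
    have : χ v = 1 := χ.one_of_mem_closedBall (by simpa using! hv)
    simp [hg, this]
  refine ⟨g, deriv g, G, hgd, hg'c, hG, fun v hv => hone v (by linarith), fun v hv => ?_⟩
  refine (hgd v).congr_of_eventuallyEq ?_
  have hopen : IsOpen {w : ℝ | |w| < R + 1} := isOpen_lt continuous_abs continuous_const
  filter_upwards [hopen.mem_nhds (show |v| < R + 1 by linarith)] with w hw
  exact (hone w (le_of_lt hw)).symm

theorem sub_le_of_quarter_le_deriv {N N' : ℝ → ℝ} {k v w : ℝ} (hN : ∀ v, HasDerivAt N (N' v) v)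
    (h : ∀ v ∈ Set.Icc (-k) k, 1 / 4 ≤ N' v) (hv : v ∈ Set.Icc (-k) k) (hw : w ∈ Set.Icc (-k) k)
    (hvw : v ≤ w) : 1 / 4 * (w - v) ≤ N w - N v := by
  have hd : ∀ v, HasDerivAt (fun v => N v - 1 / 4 * v) (N' v - 1 / 4) v := fun v =>
    ((hN v).sub ((hasDerivAt_id v).const_mul (1 / 4))).congr_deriv (by simp)
  have hmono : MonotoneOn (fun v => N v - 1 / 4 * v) (Set.Icc (-k) k) :=
    monotoneOn_of_hasDerivWithinAt_nonneg (convex_Icc _ _)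
      (fun v _ => (hd v).continuousAt.continuousWithinAt)
      (fun v _ => (hd v).hasDerivWithinAt) (fun v hv => sub_nonneg.2 (h v (interior_subset hv)))
  have := hmono hv hw hvw
  simp only at this
  linarith

/-- Existence of a bounded classical solution for well-prepared data, on every time interval. -/
theorem exists_wellPreparedSolution {lam eps : ℝ} (hlam : 0 < lam) (heps : 0 < eps)
    {f f' f'' : ℝ → ℝ} (hf : ∀ v, HasDerivAt f (f' v) v) (hf' : ∀ v, HasDerivAt f' (f'' v) v)
    (hc' : Continuous f') (hc'' : Continuous f'') (h0 : f 0 = 0) {K G : ℝ} (hK : 0 ≤ K)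
    (hG : ∀ v, |v| ≤ K + 1 → |f' v| ≤ G) (hsub : eps * G ≤ lam / 2) (hsmall : eps * lam * K ≤ 1 / 2)
    {u₀ u₁ u₂ : ℝ → ℝ} (hu₀ : ∀ x, HasDerivAt u₀ (u₁ x) x) (hu₁ : ∀ x, HasDerivAt u₁ (u₂ x) x)
    (hu₂ : Continuous u₂) (b₀ : ∀ x, |u₀ x| ≤ K) (b₁ : ∀ x, |u₁ x| ≤ K) (b₂ : ∀ x, |u₂ x| ≤ K)
    {T : ℝ} (hT : 0 < T) :
    ∃ f₁ f₂ : ℝ → ℝ → ℝ, IsWellPreparedSolution lam eps f u₀ T f₁ f₂ ∧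
      ∀ t ∈ Set.Icc 0 T, ∀ x, |f₁ t x| ≤ K + 1 ∧ |f₂ t x| ≤ K + 1 ∧ |f₁ t x + f₂ t x| ≤ K + 1 := by
  set R := K + 1 with hR
  have hR0 : 0 ≤ R := by linarith
  set N₁ := maxwellian₁ lam eps f with hN₁
  set N₂ := maxwellian₂ lam eps f with hN₂
  set N₁' : ℝ → ℝ := fun v => 1 / 2 + eps * f' v / (2 * lam) with hN₁'
  set N₂' : ℝ → ℝ := fun v => 1 / 2 - eps * f' v / (2 * lam) with hN₂'
  have d₁ : ∀ v, HasDerivAt N₁ (N₁' v) v := fun v => hasDerivAt_maxwellian₁ (hf v)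
  have d₂ : ∀ v, HasDerivAt N₂ (N₂' v) v := fun v => hasDerivAt_maxwellian₂ (hf v)
  have c₁ : Continuous N₁' := by fun_prop
  have c₂ : Continuous N₂' := by fun_prop
  have hsum : ∀ v, N₁ v + N₂ v = v := maxwellian_add lam eps f
  have hs : ∀ v ∈ Set.Icc (-R) R, -(1 / 4) ≤ eps * f' v / (2 * lam) ∧
      eps * f' v / (2 * lam) ≤ 1 / 4 := fun v hv =>
    abs_le.1 (abs_slope_le hlam heps (hG v (abs_le.2 hv)) hsub)
  obtain ⟨Λ, hΛ, hLip⟩ := exists_lipschitz_on_Icc hf' hc'' R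
  have hslope : ∀ v ∈ Set.Icc (-R) R, ∀ w ∈ Set.Icc (-R) R,
      |eps * f' v / (2 * lam) - eps * f' w / (2 * lam)| ≤ eps * Λ / (2 * lam) * |v - w| := by
    intro v hv w hw
    rw [← sub_div, ← mul_sub, abs_div, abs_mul, abs_of_pos heps,
      abs_of_pos (by positivity : 0 < 2 * lam), div_mul_eq_mul_div, mul_assoc]
    gcongr
    exact hLip v hv w hw
  have m₁ : IsMonotoneResponse R (eps * Λ / (2 * lam)) N₁ N₁' := by
    refine ⟨d₁, c₁, fun v hv => ?_, fun v hv => ?_, fun v hv w hw => ?_⟩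
    · simp only [hN₁']; linarith [(hs v hv).1]
    · simp only [hN₁']; linarith [(hs v hv).2]
    · simp only [hN₁', add_sub_add_left_eq_sub]; exact hslope v hv w hw
  have m₂ : IsMonotoneResponse R (eps * Λ / (2 * lam)) N₂ N₂' := by
    refine ⟨d₂, c₂, fun v hv => ?_, fun v hv => ?_, fun v hv w hw => ?_⟩
    · simp only [hN₂']; linarith [(hs v hv).2]
    · simp only [hN₂']; linarith [(hs v hv).1]
    · simp only [hN₂', sub_sub_sub_cancel_left]
      rw [abs_sub_comm]
      exact hslope v hv w hw
  have l₁ : ∀ v ∈ Set.Icc (-R) R, 1 / 4 ≤ N₁' v := fun v hv => by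
    simp only [hN₁']; linarith [(hs v hv).1]
  have l₂ : ∀ v ∈ Set.Icc (-R) R, 1 / 4 ≤ N₂' v := fun v hv => by
    simp only [hN₂']; linarith [(hs v hv).2]
  have i₀ : ∀ x, u₀ x ∈ Set.Icc (-R) R := fun x =>
    abs_le.1 ((b₀ x).trans (by linarith))
  have iR : R ∈ Set.Icc (-R) R := ⟨by linarith, le_rfl⟩
  have iR' : -R ∈ Set.Icc (-R) R := ⟨le_rfl, by linarith⟩
  have hpert : ∀ x, |eps * lam / 2 * u₁ x| ≤ 1 / 4 := fun x => by
    rw [abs_mul, abs_of_pos (by positivity : 0 < eps * lam / 2)]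
    calc eps * lam / 2 * |u₁ x| ≤ eps * lam / 2 * K := by gcongr; exact b₁ x
      _ ≤ 1 / 4 := by linarith
  have hder : ∀ x, deriv u₀ x = u₁ x := fun x => (hu₀ x).deriv
  -- As |u₀| ≤ K = R - 1 and the slope is at least 1/4, N(u₀) is at distance at least 1/4 from
  -- N(±R), enough for the correction bounded in `hpert`.
  have room : ∀ {N N' : ℝ → ℝ}, (∀ v, HasDerivAt N (N' v) v) →
      (∀ v ∈ Set.Icc (-R) R, 1 / 4 ≤ N' v) → ∀ x,
      N (-R) + 1 / 4 ≤ N (u₀ x) ∧ N (u₀ x) + 1 / 4 ≤ N R := by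
    intro N N' hd hl x
    have hx := abs_le.1 (b₀ x)
    have r₁ := sub_le_of_quarter_le_deriv hd hl iR' (i₀ x) (i₀ x).1
    have r₂ := sub_le_of_quarter_le_deriv hd hl (i₀ x) iR (i₀ x).2
    constructor <;> linarith [hx.1, hx.2]
  have hφ₁ : ∀ x, HasDerivAt (wellPrepared₁ lam eps f u₀)
      (N₁' (u₀ x) * u₁ x - eps * lam / 2 * u₂ x) x := by
    intro x
    have : wellPrepared₁ lam eps f u₀ = fun x => N₁ (u₀ x) - eps * lam / 2 * u₁ x := by
      funext y; simp only [wellPrepared₁, hder, hN₁]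
    rw [this]
    exact ((d₁ _).comp x (hu₀ x)).sub ((hu₁ x).const_mul _)
  have hφ₂ : ∀ x, HasDerivAt (wellPrepared₂ lam eps f u₀)
      (N₂' (u₀ x) * u₁ x + eps * lam / 2 * u₂ x) x := by
    intro x
    have : wellPrepared₂ lam eps f u₀ = fun x => N₂ (u₀ x) + eps * lam / 2 * u₁ x := by
      funext y; simp only [wellPrepared₂, hder, hN₂]
    rw [this]
    exact ((d₂ _).comp x (hu₀ x)).add ((hu₁ x).const_mul _)
  have cu₀ : Continuous u₀ := continuous_iff_continuousAt.2 fun x => (hu₀ x).continuousAt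
  have cu₁ : Continuous u₁ := continuous_iff_continuousAt.2 fun x => (hu₁ x).continuousAt
  have hP : ∀ {n a b : ℝ}, |n| ≤ 1 → |a| ≤ K → |b| ≤ K → |n * a| + |eps * lam / 2 * b| ≤
      K + eps * lam / 2 * K := by
    intro n a b hn ha hb
    rw [abs_mul, abs_mul, abs_of_pos (by positivity : 0 < eps * lam / 2)]
    have : |n| * |a| ≤ 1 * K := by gcongr
    gcongr
    linarith
  obtain ⟨f₁, f₂, C₁, C₂, I₁, I₂, E₁, E₂, B⟩ := exists_relaxation_solution (κ := 1 / eps ^ 2)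
    (c := lam / eps) (k := R) (Λ := eps * Λ / (2 * lam)) (P := K + eps * lam / 2 * K)
    (by positivity) hR0 (by positivity) hφ₁ hφ₂ (by fun_prop) (by fun_prop) m₁ m₂ hsum
    (fun x => by
      have := room d₁ l₁ x
      have hp := abs_le.1 (hpert x)
      simp only [wellPrepared₁, hder]
      constructor <;> linarith [this.1, this.2, hp.1, hp.2])
    (fun x => by
      have := room d₂ l₂ x
      have hp := abs_le.1 (hpert x)
      simp only [wellPrepared₂, hder]
      constructor <;> linarith [this.1, this.2, hp.1, hp.2])
    (fun x => (abs_sub _ _).trans (hP (m₁.abs_deriv_le (i₀ x)) (b₁ x) (b₂ x)))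
    (fun x => (abs_add_le _ _).trans (hP (m₂.abs_deriv_le (i₀ x)) (b₁ x) (b₂ x)))
  have dw : ∀ {w : ℝ → ℝ → ℝ}, ContDiff ℝ 1 (fun p : ℝ × ℝ => w p.1 p.2) →
      ∀ t ∈ Set.Icc 0 T, ∀ x, derivWithin (fun τ => w τ x) (Set.Icc 0 T) t =
        deriv (fun τ => w τ x) t := by
    intro w hw t ht x
    refine DifferentiableAt.derivWithin ?_ (uniqueDiffOn_Icc hT t ht)
    exact (hw.differentiable one_ne_zero (t, x)).comp t (f := fun τ => (τ, x)) (by fun_prop)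
  refine ⟨f₁, f₂, ⟨⟨C₁.contDiffOn, C₂.contDiffOn, fun t ht x => ?_, fun t ht x => ?_⟩, I₁, I₂⟩,
    fun t ht x => ?_⟩
  · rw [dw C₁ t ht x]; exact E₁ t x ht.1
  · rw [dw C₂ t ht x, sub_eq_add_neg, ← neg_mul]; exact E₂ t x ht.1
  · obtain ⟨⟨a₁, a₂⟩, a₃, a₄⟩ := B t x ht.1
    have i00 : (0 : ℝ) ∈ Set.Icc (-R) R := ⟨by linarith, hR0⟩
    -- Since f(0) = 0, the Maxwellians vanish at 0; being 1-Lipschitz on [-R, R], they map ±R into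
    -- [-R, R]. This bounds f₁ and f₂ separately.
    have bnd : ∀ {N N' : ℝ → ℝ}, IsMonotoneResponse R (eps * Λ / (2 * lam)) N N' → N 0 = 0 →
        -R ≤ N (-R) ∧ N R ≤ R := by
      intro N N' hN hN0
      have e₁ := hN.abs_sub_le iR' i00
      have e₂ := hN.abs_sub_le iR i00
      rw [hN0, sub_zero, sub_zero, abs_neg, abs_of_nonneg hR0] at e₁
      rw [hN0, sub_zero, sub_zero, abs_of_nonneg hR0] at e₂
      exact ⟨(abs_le.1 e₁).1, (abs_le.1 e₂).2⟩
    have q₁ := bnd m₁ (by simp [hN₁, maxwellian₁, h0])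
    have q₂ := bnd m₂ (by simp [hN₂, maxwellian₂, h0])
    have s₁ := hsum R
    have s₂ := hsum (-R)
    refine ⟨abs_le.2 ⟨?_, ?_⟩, abs_le.2 ⟨?_, ?_⟩, abs_le.2 ⟨?_, ?_⟩⟩ <;>
      linarith [q₁.1, q₁.2, q₂.1, q₂.2]

/-- Classical solutions with the same well-prepared data agree. -/
theorem IsWellPreparedSolution.unique {lam eps T : ℝ} (hlam : 0 < lam) (heps : 0 < eps)
    (hT : 0 < T) {f f' u₀ : ℝ → ℝ} (hf : ∀ v, HasDerivAt f (f' v) v) (hf' : Continuous f')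
    {f₁ f₂ g₁ g₂ : ℝ → ℝ → ℝ} (hfs : IsWellPreparedSolution lam eps f u₀ T f₁ f₂)
    (hgs : IsWellPreparedSolution lam eps f u₀ T g₁ g₂) :
    ∀ t ∈ Set.Icc 0 T, ∀ x, f₁ t x = g₁ t x ∧ f₂ t x = g₂ t x := by
  refine relaxation_solution_unique (c := lam / eps) (κ := 1 / eps ^ 2)
    (N₁ := maxwellian₁ lam eps f) (N₂ := maxwellian₂ lam eps f) hT (by positivity) (fun r => ?_)
    hfs.contDiffOn₁ hfs.contDiffOn₂ hgs.contDiffOn₁ hgs.contDiffOn₂ hfs.eqn₁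
    (fun t ht x => ?_) hgs.eqn₁ (fun t ht x => ?_) (fun x => ?_) (fun x => ?_)
  · obtain ⟨L₁, h₁, hL₁⟩ := exists_lipschitz_on_Icc
      (fun v => hasDerivAt_maxwellian₁ (lam := lam) (eps := eps) (hf v)) (by fun_prop) r
    obtain ⟨L₂, h₂, hL₂⟩ := exists_lipschitz_on_Icc
      (fun v => hasDerivAt_maxwellian₂ (lam := lam) (eps := eps) (hf v)) (by fun_prop) r
    refine ⟨max L₁ L₂, le_max_of_le_left h₁, fun v hv w hw => ⟨?_, ?_⟩⟩
    · exact (hL₁ v hv w hw).trans (by gcongr; exact le_max_left _ _)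
    · exact (hL₂ v hv w hw).trans (by gcongr; exact le_max_right _ _)
  · rw [neg_mul, ← sub_eq_add_neg]; exact hfs.eqn₂ t ht x
  · rw [neg_mul, ← sub_eq_add_neg]; exact hgs.eqn₂ t ht x
  · rw [hfs.init₁, hgs.init₁]
  · rw [hfs.init₂, hgs.init₂]

theorem lemma2 (lam : ℝ) (hlam : 0 < lam) (a : ℝ) (f : ℝ → ℝ) (hf : FluxAssumptions a f)
    (s : ℝ) (hs : 1 / 2 + 1 < s) (M₀ : ℝ≥0) :
    ∃ Tstar > (0 : ℝ), ∃ eps₀ > (0 : ℝ), ∃ R > (0 : ℝ),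
      ∀ η : ℝ → ℝ, IsQuadraticEntropy f η →
        ∃ c > (0 : ℝ), ∃ C > (0 : ℝ), ∀ eps : ℝ, 0 < eps → eps ≤ eps₀ →
          ∃ H₁ H₂ : ℝ → ℝ,
            IsKineticEntropy lam eps f η R c H₁ H₂ ∧
            (∀ v : ℝ, |v| ≤ R →
              deriv H₁ (maxwellian₁ lam eps f v) = deriv η v ∧
              deriv H₂ (maxwellian₂ lam eps f v) = deriv η v ∧
              |deriv (deriv H₁) (maxwellian₁ lam eps f v) - 2 * deriv (deriv η) v| ≤ C * eps ∧
              |deriv (deriv H₂) (maxwellian₂ lam eps f v) - 2 * deriv (deriv η) v| ≤ C * eps) ∧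
            (∀ u₀ : ℝ → ℝ, Continuous u₀ → sobolevNorm (s + 1) u₀ ≤ (M₀ : ℝ≥0∞) →
              (∃ f₁ f₂ : ℝ → ℝ → ℝ, IsWellPreparedSolution lam eps f u₀ Tstar f₁ f₂) ∧
              (∀ f₁ f₂ : ℝ → ℝ → ℝ, IsWellPreparedSolution lam eps f u₀ Tstar f₁ f₂ →
                (∀ t ∈ Set.Icc 0 Tstar, ∀ x : ℝ,
                  |f₁ t x| ≤ R ∧ |f₂ t x| ≤ R ∧ |f₁ t x + f₂ t x| ≤ R) ∧
                SatisfiesEntropyInequality lam eps f Tstar c H₁ H₂ f₁ f₂)) := by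

  obtain ⟨hf2, f', f'', hfd, hfd', hc', hc''⟩ := hf.exists_derivs
  obtain ⟨A, hA⟩ := sobolevNorm_embedding (σ := s + 1) (by linarith)
  set K : ℝ := A * M₀ with hK
  have hK0 : 0 ≤ K := by positivity
  have hR : 0 < K + 1 := by positivity
  obtain ⟨g, g', G, hg, hgc, hG, hgf, hgf'⟩ := exists_cutoff hf2 hR
  have hG0 : 0 ≤ G := (abs_nonneg _).trans (hG 0)
  have hff : ∀ v, |v| ≤ K + 1 → |f' v| ≤ G := fun v hv => by
    rw [(hfd v).unique (hgf' v hv)]; exact hG v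
  -- The solutions are global, so T* = 1 is an arbitrary choice. The two entries of the minimum give
  -- ε G ≤ λ/2 and ε λ K ≤ 1/2; G + 1 and K + 1 avoid zero denominators.
  refine ⟨1, one_pos, min (lam / (2 * (G + 1))) (1 / (2 * lam * (K + 1))), by positivity, K + 1, hR,
    fun η hη => ?_⟩
  obtain ⟨α, β, γ, hα, hηq⟩ := hη.quadratic
  -- The summand 1 keeps C positive when G = 0.
  refine ⟨2 * α, by positivity, 8 * α * G / lam + 1, by positivity, fun eps heps hle => ?_⟩
  have hsub : eps * G ≤ lam / 2 := by
    have := hle.trans (min_le_left _ _)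
    rw [le_div_iff₀ (by positivity)] at this
    linarith
  have hsmall : eps * lam * K ≤ 1 / 2 := by
    have := hle.trans (min_le_right _ _)
    rw [le_div_iff₀ (by positivity)] at this
    nlinarith [mul_pos heps hlam]
  -- The entropy is built for the cut-off flux, whose slope bound is global, and then transferred to
  -- f on |v| ≤ R.
  obtain ⟨H₁, H₂, hH, hHd⟩ := exists_kineticEntropy hlam heps hg hgc hG hsub hα hηq (K + 1)
  have hH' := hH.congr_flux hgf
  refine ⟨H₁, H₂, hH', fun v hv => ?_, fun u₀ hu₀ hnorm => ?_⟩
  · have e₁ : maxwellian₁ lam eps f v = maxwellian₁ lam eps g v := by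
      simp only [maxwellian₁, hgf v hv]
    have e₂ : maxwellian₂ lam eps f v = maxwellian₂ lam eps g v := by
      simp only [maxwellian₂, hgf v hv]
    rw [e₁, e₂]
    obtain ⟨k₁, k₂, k₃, k₄⟩ := hHd v
    have hC : 8 * α * G / lam * eps ≤ (8 * α * G / lam + 1) * eps := by gcongr; linarith
    exact ⟨k₁, k₂, k₃.trans hC, k₄.trans hC⟩
  · obtain ⟨u₁, u₂, d₀, d₁, c₂, b₀, b₁, b₂⟩ := hA M₀ u₀ hu₀ hnorm
    obtain ⟨g₁, g₂, hsol, hbd⟩ := exists_wellPreparedSolution hlam heps hfd hfd' hc' hc''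
      hf.map_zero hK0 hff hsub hsmall d₀ d₁ c₂ b₀ b₁ b₂ one_pos
    refine ⟨⟨g₁, g₂, hsol⟩, fun f₁ f₂ hfs => ?_⟩
    -- An arbitrary classical solution coincides with the constructed one and inherits its bounds.
    have huniq := hfs.unique hlam heps one_pos hfd hc' hsol
    have hb : ∀ t ∈ Set.Icc (0 : ℝ) 1, ∀ x : ℝ,
        |f₁ t x| ≤ K + 1 ∧ |f₂ t x| ≤ K + 1 ∧ |f₁ t x + f₂ t x| ≤ K + 1 := by
      intro t ht x
      rw [(huniq t ht x).1, (huniq t ht x).2]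
      exact hbd t ht x
    exact ⟨hb, hH'.satisfiesEntropyInequality one_pos hfs.toIsBGKSolution
      fun t ht x => (hb t ht x).2.2⟩
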